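/- **Syntax.** Let $\mathsf{Act}$ be a finite set of visible actions, $\tau\notin\mathsf{Act}$, $\mathsf{Act}_\tau=\mathsf{Act}\cup\{\tau\}$. The process terms $P$ of $\mathsf{pCSP}$ and the state-based terms $S$ of $\mathsf{sCSP}$ are given by $$P ::= S \mid P\,{}_p\!\oplus P,\qquad S ::= \mathbf 0 \mid a.P \mid P\sqcap P \mid S\,\Box\,S \mid S\,|_A\,S$$ with $a\in\mathsf{Act}$, $A\subseteq\mathsf{Act}$, and $p$ real, $0<p<1$. The sub-language $\mathsf{nCSP}$ consists of the terms of $\mathsf{pCSP}$ without any $|_A$. For arbitrary terms $P,Q$ of $\mathsf{pCSP}$, $P\,\Box\,Q$ abbreviates the term obtained by distributing $\Box$ over ${}_p\oplus$. **Operational semantics.** Let $\mathcal D(\mathsf{sCSP})$ be the set of finitely supported probability distributions on $\mathsf{sCSP}$, and $\overline s$ the point distribution at $s$. Put $[\![s]\!]=\overline s$ for $s\in\mathsf{sCSP}$ and $[\![P\,{}_p\!\oplus Q]\!]=p\,[\![P]\!]+(1-p)[\![Q]\!]$. The transitions $s\xrightarrow{\alpha}\Delta$ ($s\in\mathsf{sCSP}$,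 $\alpha\in\mathsf{Act}_\tau$, $\Delta\in\mathcal D(\mathsf{sCSP})$) are the least ones with (here $a\in\mathsf{Act}$, and operators are extended linearly to distributions): - $a.P\xrightarrow{a}[\![P]\!]$; $P\sqcap Q\xrightarrow{\tau}[\![P]\!]$; $P\sqcap Q\xrightarrow{\tau}[\![Q]\!]$; - if $s\xrightarrow{a}\Delta$ then $s\,\Box\,t\xrightarrow{a}\Delta$ and $t\,\Box\,s\xrightarrow{a}\Delta$; if $s\xrightarrow{\tau}\Delta$ then $s\,\Box\,t\xrightarrow{\tau}\Delta\,\Box\,t$ and $t\,\Box\,s\xrightarrow{\tau}t\,\Box\,\Delta$; - if $s\xrightarrow{\alpha}\Delta$ and $\alpha\notin A$ then $s\,|_A\,t\xrightarrow{\alpha}\Delta\,|_A\,t$ and $t\,|_A\,s\xrightarrow{\alpha}t\,|_A\,\Delta$; if $a\in A$, $s\xrightarrow{a}\Delta$ and $t\xrightarrow{a}\Theta$ then $s\,|_A\,t\xrightarrow{\tau}\Delta\,|_A\,\Theta$. **Simulation preorders.** For $R\subseteq\mathsf{sCSP}\times\mathcal D(\mathsf{sCSP})$ let $\Delta\,\overline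 R\,\Theta$ mean that there are a finite index set $I$, a probability distribution $(p_i)_{i\in I}$, states $s_i$ and distributions $\Phi_i$ with $\Delta=\sum_i p_i\overline{s_i}$, $s_i\,R\,\Phi_i$ for all $i\in I$, and $\Theta=\sum_i p_i\Phi_i$. Write $s\xrightarrow{\hat\tau}\Delta$ if $s\xrightarrow{\tau}\Delta$ or $\Delta=\overline s$. Let $\stackrel{\hat\tau}{\Longrightarrow}$ be the reflexive-transitive closure of the lifting of $\xrightarrow{\hat\tau}$, and for $a\in\mathsf{Act}$ let $\stackrel{\hat a}{\Longrightarrow}$ be the composition of $\stackrel{\hat\tau}{\Longrightarrow}$, the lifting of $\xrightarrow{a}$, and $\stackrel{\hat\tau}{\Longrightarrow}$. For $X\subseteq\mathsf{Act}$ write $s\not\xrightarrow{X}$ if $s$ has no transition with a label in $X\cup\{\tau\}$, and $\Delta\not\xrightarrow{X}$ if this holds for every $s$ in the support of $\Delta$. A relation $R\subseteq\mathsf{sCSP}\times\mathcal D(\mathsf{sCSP})$ is a *simulation* if $s\,R\,\Theta$ and $s\xrightarrow{\alpha}\Delta$ imply that $\Theta\stackrel{\hat\alpha}{\Longrightarrow}\Theta'$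 and $\Delta\,\overline R\,\Theta'$ for some $\Theta'$. It is a *failure simulation* if moreover $s\,R\,\Theta$ and $s\not\xrightarrow{X}$ imply that $\Theta\stackrel{\hat\tau}{\Longrightarrow}\Theta'$ and $\Theta'\not\xrightarrow{X}$ for some $\Theta'$. Let $s\lhd_S\Theta$ (resp. $s\lhd_{FS}\Theta$) mean that some simulation (resp. failure simulation) relates $s$ to $\Theta$. Then - $P\sqsubseteq_S Q$ iff $[\![Q]\!]\stackrel{\hat\tau}{\Longrightarrow}\Theta$ for some $\Theta$ with $[\![P]\!]\,\overline{\lhd_S}\,\Theta$; - $P\sqsubseteq_{FS}Q$ iff $[\![P]\!]\stackrel{\hat\tau}{\Longrightarrow}\Theta$ for some $\Theta$ with $[\![Q]\!]\,\overline{\lhd_{FS}}\,\Theta$. **Axioms.** The *common equations* are - (P1) $P\,{}_p\!\oplus P=P$; (P2) $P\,{}_p\!\oplus Q=Q\,{}_{1-p}\!\oplus P$; (P3) $(P\,{}_p\!\oplus Q)\,{}_q\!\oplus R=P\,{}_{pq}\!\oplus(Q\,{}_{r}\!\oplus R)$ with $r=\frac{(1-p)q}{1-pq}$; - (I1) $P\sqcap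 P=P$; (I2) $P\sqcap Q=Q\sqcap P$; (I3) $(P\sqcap Q)\sqcap R=P\sqcap(Q\sqcap R)$; - (E1) $P\,\Box\,\mathbf 0=P$; (E2) $P\,\Box\,Q=Q\,\Box\,P$; (E3) $(P\,\Box\,Q)\,\Box\,R=P\,\Box\,(Q\,\Box\,R)$; - (EI) $a.P\,\Box\,a.Q=a.P\sqcap a.Q$; (D1) $P\,\Box\,(Q\,{}_p\!\oplus R)=(P\,\Box\,Q)\,{}_p\!\oplus(P\,\Box\,R)$; (D2) $a.P\,\Box\,(Q\sqcap R)=(a.P\,\Box\,Q)\sqcap(a.P\,\Box\,R)$; - (D3) $(P_1\sqcap P_2)\,\Box\,(Q_1\sqcap Q_2)=(P_1\,\Box\,(Q_1\sqcap Q_2))\sqcap(P_2\,\Box\,(Q_1\sqcap Q_2))\sqcap((P_1\sqcap P_2)\,\Box\,Q_1)\sqcap((P_1\sqcap P_2)\,\Box\,Q_2)$. The *may axioms* are - (May0) $a.P\,\Box\,b.Q=a.P\sqcap b.Q$; (May1) $P\sqsubseteq P\sqcap Q$; (May2) $\mathbf 0\sqsubseteq P$; (May3) $a.(P\,{}_p\!\oplus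 Q)\sqsubseteq a.P\,{}_p\!\oplus a.Q$. The *must axioms* are - (Must1) $P\sqcap Q\sqsubseteq Q$; - (Must2) $R\sqcap\bigsqcap_{i\in I}\bigoplus_{j\in J_i}p_{ij}\cdot(a_i.Q_{ij}\,\Box\,P_{ij})\sqsubseteq\Box_{i\in I}\,a_i.\bigoplus_{j\in J_i}p_{ij}\cdot Q_{ij}$, provided $\mathrm{init}(R)\subseteq\{a_i\mid i\in I\}$, for finite $I$ and finite nonempty $J_i$, $p_{ij}>0$ and $\sum_{j\in J_i}p_{ij}=1$ (if $I=\emptyset$, the left side is $R$ and the right side is $\mathbf 0$). Here $\mathrm{init}(\mathbf 0)=\emptyset$, $\mathrm{init}(a.P)=\{a\}$, $\mathrm{init}(P\sqcap Q)=\{\tau\}$, and $\mathrm{init}(P\,{}_p\!\oplus Q)=\mathrm{init}(P\,\Box\,Q)=\mathrm{init}(P)\cup\mathrm{init}(Q)$. Write $P\sqsubseteq_{E_{\mathrm{may}}}Q$ (resp. $P\sqsubseteq_{E_{\mathrm{must}}}Q$) if $P\sqsubseteq Q$ is derivable from the common equations and the may axioms (resp. the must axioms), that is, if $(P,Q)$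 is in the least preorder on $\mathsf{nCSP}$ that contains all instances in $\mathsf{nCSP}$ of these axioms (an equation counts as two inequations) and is preserved by the operators $a.\_$, $\sqcap$, $\Box$ and ${}_p\oplus$. **Theorem.** For all $P,Q\in\mathsf{nCSP}$: 1. $P\sqsubseteq_S Q$ if and only if $P\sqsubseteq_{E_{\mathrm{may}}}Q$; 2. $P\sqsubseteq_{FS}Q$ if and only if $P\sqsubseteq_{E_{\mathrm{must}}}Q$. -/

import Mathlib

open Convexity

/-! ## Syntax of finite probabilistic CSP -/

/-- A real number strictly between `0` and `1`. -/
abbrev Prb : Type := Set.Ioo (0 : ℝ) 1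

mutual

/-- Process terms `P ::= S | P ₚ⊕ P`. -/
inductive PCSP.{u} (Act : Type u) : Type u
  | state : SCSP Act → PCSP Act
  | prob : Prb → PCSP Act → PCSP Act → PCSP Act

/-- State-based process terms `S ::= 0 | a.P | P ⊓ P | S □ S | S |_A S`. -/
inductive SCSP.{u} (Act : Type u) : Type u
  | nil : SCSP Act
  | pre : Act → PCSP Act → SCSP Act
  | int : PCSP Act → PCSP Act → SCSP Act
  | ext : SCSP Act → SCSP Act → SCSP Act
  | par : Set Act → SCSP Act → SCSP Act → SCSP Act

end

mutual

/-- The process term does not use the parallel operators `|_A`. -/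
def PCSP.ParFree {Act : Type*} : PCSP Act → Prop
  | .state s => s.ParFree
  | .prob _ P Q => P.ParFree ∧ Q.ParFree

/-- The state-based process term does not use the parallel operators `|_A`. -/
def SCSP.ParFree {Act : Type*} : SCSP Act → Prop
  | .nil => True
  | .pre _ P => P.ParFree
  | .int P Q => P.ParFree ∧ Q.ParFree
  | .ext s t => s.ParFree ∧ t.ParFree
  | .par _ _ _ => False

end

/-- The sub-language nCSP of pCSP: the terms without parallel composition. -/
def nCSP (Act : Type*) : Set (PCSP Act) := {P | P.ParFree}

/-! ## Operational semantics -/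

/-- Labels of transitions: `some a` is the visible action `a`, and `none` is the internal
action `τ`. -/
abbrev Label (Act : Type*) : Type _ := Option Act

/-- Probability distributions with finite support. -/
abbrev FDist (S : Type*) : Type _ := StdSimplex ℝ S

/-- The interpretation of a process term as a distribution over state-based terms. -/
noncomputable def PCSP.den {Act : Type*} : PCSP Act → FDist (SCSP Act)
  | .state s => StdSimplex.single s
  | .prob p P Q =>
      convexCombPair (p : ℝ) (1 - p) p.2.1.le (sub_nonneg.2 p.2.2.le) (add_sub_cancel _ _)
        P.den Q.den

/-- The transition relation `s --α--> Δ` of the probabilistic labelled transition system of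
state-based terms. -/
inductive Step {Act : Type*} : SCSP Act → Label Act → FDist (SCSP Act) → Prop
  | action (a : Act) (P : PCSP Act) : Step (.pre a P) (some a) P.den
  | int_l (P Q : PCSP Act) : Step (.int P Q) none P.den
  | int_r (P Q : PCSP Act) : Step (.int P Q) none Q.den
  | ext_l {s t : SCSP Act} {a : Act} {Δ : FDist (SCSP Act)} :
      Step s (some a) Δ → Step (.ext s t) (some a) Δ
  | ext_r {s t : SCSP Act} {a : Act} {Δ : FDist (SCSP Act)} :
      Step t (some a) Δ → Step (.ext s t) (some a) Δ
  | ext_i_l {s t : SCSP Act} {Δ : FDist (SCSP Act)} :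
      Step s none Δ → Step (.ext s t) none (Δ.map fun s' => .ext s' t)
  | ext_i_r {s t : SCSP Act} {Δ : FDist (SCSP Act)} :
      Step t none Δ → Step (.ext s t) none (Δ.map fun t' => .ext s t')
  | par_l {A : Set Act} {s t : SCSP Act} {α : Label Act} {Δ : FDist (SCSP Act)} :
      α ∉ some '' A → Step s α Δ → Step (.par A s t) α (Δ.map fun s' => .par A s' t)
  | par_r {A : Set Act} {s t : SCSP Act} {α : Label Act} {Δ : FDist (SCSP Act)} :
      α ∉ some '' A → Step t α Δ → Step (.par A s t) α (Δ.map fun t' => .par A s t')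
  | par_i {A : Set Act} {s t : SCSP Act} {a : Act} {Δ Θ : FDist (SCSP Act)} :
      a ∈ A → Step s (some a) Δ → Step t (some a) Θ →
      Step (.par A s t) none (iConvexComb Δ fun s' => Θ.map fun t' => .par A s' t')

/-! ## Simulations and failure simulations -/

/-- The lifting of a relation between states and distributions to a relation between
distributions: `Δ = ∑ i, p i • s̄ i`, `R (s i) (Φ i)` for each `i`, and `Θ = ∑ i, p i • Φ i`, where
`i` ranges over a finite index set. -/
def Lift {S : Type*} (R : S → FDist S → Prop) (Δ Θ : FDist S) : Prop :=
  ∃ (n : ℕ) (p : FDist (Fin n)) (s : Fin n → S) (Φ : Fin n → FDist S),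
    Δ = iConvexComb p (fun i => (StdSimplex.single (s i) : FDist S)) ∧
    (∀ i, R (s i) (Φ i)) ∧
    Θ = iConvexComb p Φ

/-- `s --τ̂--> Δ`: either a `τ` step, or `Δ` is the point distribution at `s`. -/
def HatTau {Act : Type*} (s : SCSP Act) (Δ : FDist (SCSP Act)) : Prop :=
  Step s none Δ ∨ Δ = StdSimplex.single s

/-- `Δ ==τ̂==> Θ`: the reflexive and transitive closure of the lifted relation `--τ̂-->`. -/
def WeakTau {Act : Type*} : FDist (SCSP Act) → FDist (SCSP Act) → Prop :=
  Relation.ReflTransGen (Lift HatTau)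

/-- `Δ ==α̂==> Θ`: for `α = τ` the relation `==τ̂==>`, and for a visible action `a` the
composition of `==τ̂==>`, the lifted relation `--a-->`, and `==τ̂==>`. -/
def Weak {Act : Type*} : Label Act → FDist (SCSP Act) → FDist (SCSP Act) → Prop
  | none, Δ, Θ => WeakTau Δ Θ
  | some a, Δ, Θ => ∃ Δ₁ Δ₂, WeakTau Δ Δ₁ ∧ Lift (fun s => Step s (some a)) Δ₁ Δ₂ ∧ WeakTau Δ₂ Θ

/-- `s` has neither a `τ` transition nor a transition labelled by an element of `X`. -/
def SCSP.Refuses {Act : Type*} (s : SCSP Act) (X : Set Act) : Prop :=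
  ∀ α ∈ insert (none : Label Act) (some '' X), ¬ ∃ Δ, Step s α Δ

/-- Every state in the support of `Δ` refuses `X`. -/
def RefusesDist {Act : Type*} (Δ : FDist (SCSP Act)) (X : Set Act) : Prop :=
  ∀ s ∈ Δ.weights.support, s.Refuses X

/-- Simulations. -/
def IsSimulation {Act : Type*} (R : SCSP Act → FDist (SCSP Act) → Prop) : Prop :=
  ∀ s Θ, R s Θ → ∀ α Δ, Step s α Δ → ∃ Θ', Weak α Θ Θ' ∧ Lift R Δ Θ'

/-- Failure simulations. -/
def IsFailureSimulation {Act : Type*} (R : SCSP Act → FDist (SCSP Act) → Prop) : Prop :=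
  (∀ s Θ, R s Θ → ∀ α Δ, Step s α Δ → ∃ Θ', Weak α Θ Θ' ∧ Lift R Δ Θ') ∧
  (∀ s Θ, R s Θ → ∀ X : Set Act, s.Refuses X → ∃ Θ', WeakTau Θ Θ' ∧ RefusesDist Θ' X)

/-- `s ◁_S Θ`: some simulation relates `s` to `Θ`. -/
def SimBy {Act : Type*} (s : SCSP Act) (Θ : FDist (SCSP Act)) : Prop :=
  ∃ R, IsSimulation R ∧ R s Θ

/-- `s ◁_FS Θ`: some failure simulation relates `s` to `Θ`. -/
def FailSimBy {Act : Type*} (s : SCSP Act) (Θ : FDist (SCSP Act)) : Prop :=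
  ∃ R, IsFailureSimulation R ∧ R s Θ

/-- The simulation preorder `P ⊑_S Q`. -/
def SimLE {Act : Type*} (P Q : PCSP Act) : Prop :=
  ∃ Θ, WeakTau Q.den Θ ∧ Lift SimBy P.den Θ

/-- The failure simulation preorder `P ⊑_FS Q`; note that the roles of `P` and `Q` are opposite
to those in the simulation preorder. -/
def FailSimLE {Act : Type*} (P Q : PCSP Act) : Prop :=
  ∃ Θ, WeakTau P.den Θ ∧ Lift FailSimBy Q.den Θ

/-! ## Operators on process terms -/

namespace PCSP

variable {Act : Type*}

/-- The process `0`. -/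
def nil : PCSP Act := .state .nil

/-- The process `a.P`. -/
def pre (a : Act) (P : PCSP Act) : PCSP Act := .state (.pre a P)

/-- The process `P ⊓ Q`. -/
def int (P Q : PCSP Act) : PCSP Act := .state (.int P Q)

/-- `P □ t`, distributing `□` over the probabilistic choices at the top of `P`. -/
def extState : PCSP Act → SCSP Act → PCSP Act
  | .state s, t => .state (.ext s t)
  | .prob p P Q, t => .prob p (P.extState t) (Q.extState t)

/-- `P □ Q` for arbitrary process terms, distributing `□` over the probabilistic choices at the
top of `P` and `Q`. -/
def ext (P : PCSP Act) : PCSP Act → PCSP Act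
  | .state t => P.extState t
  | .prob p Q R => .prob p (P.ext Q) (P.ext R)

/-- The internal choice of a nonempty finite family of processes. -/
def bigInt : (n : ℕ) → (Fin (n + 1) → PCSP Act) → PCSP Act
  | 0, P => P 0
  | n + 1, P => int (P 0) (bigInt n fun i => P i.succ)

/-- `R ⊓ ⨅ i, P i` for a finite family `P`; this is just `R` if the family is empty. -/
def intFamily (R : PCSP Act) : (n : ℕ) → (Fin n → PCSP Act) → PCSP Act
  | 0, _ => R
  | n + 1, P => int R (bigInt n P)

/-- The external choice of a finite family of processes; this is `0` if the family is empty. -/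
def bigExt : (n : ℕ) → (Fin n → PCSP Act) → PCSP Act
  | 0, _ => nil
  | 1, P => P 0
  | n + 2, P => ext (P 0) (bigExt (n + 1) fun i => P i.succ)

theorem weight_mem {n : ℕ} (w : Fin (n + 2) → ℝ) (hw : ∀ i, 0 < w i) :
    w 0 / ∑ i, w i ∈ Set.Ioo (0 : ℝ) 1 := by
  have h : 0 < ∑ i : Fin (n + 1), w i.succ :=
    Finset.sum_pos (fun i _ => hw i.succ) Finset.univ_nonempty
  have h0 := hw 0
  rw [Fin.sum_univ_succ]
  exact ⟨by positivity, by rw [div_lt_one (by positivity)]; linarith⟩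

/-- The probabilistic choice `⨁ i, w i · P i` of a nonempty finite family of processes. The
positive weights are normalized at each binary choice; when they add up to `1`, as they do
wherever this is used, `P i` has probability `w i`. -/
noncomputable def bigProb :
    (n : ℕ) → (w : Fin (n + 1) → ℝ) → (∀ i, 0 < w i) → (Fin (n + 1) → PCSP Act) → PCSP Act
  | 0, _, _, P => P 0
  | n + 1, w, hw, P =>
      .prob ⟨w 0 / ∑ i, w i, weight_mem w hw⟩ (P 0)
        (bigProb n (fun i => w i.succ) (fun i => hw i.succ) fun i => P i.succ)

end PCSP

mutual

/-- The set of initial actions of a process term. -/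
def PCSP.inits {Act : Type*} : PCSP Act → Set (Label Act)
  | .state s => s.inits
  | .prob _ P Q => P.inits ∪ Q.inits

/-- The set of initial actions of a state-based process term. (The clause for parallel
composition is immaterial: initial actions are only used for terms of nCSP.) -/
def SCSP.inits {Act : Type*} : SCSP Act → Set (Label Act)
  | .nil => ∅
  | .pre a _ => {some a}
  | .int _ _ => {none}
  | .ext s t => s.inits ∪ t.inits
  | .par A s t =>
      ((s.inits ∪ t.inits) \ (some '' A)) ∪
        {α | α = none ∧ ∃ a ∈ A, some a ∈ s.inits ∧ some a ∈ t.inits}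

end

/-! ## Equational and inequational theories -/

namespace Prb

/-- `1 - p`. -/
def compl (p : Prb) : Prb := ⟨1 - p, by have := p.2.1; have := p.2.2; constructor <;> linarith⟩

/-- `p * q`. -/
def mul (p q : Prb) : Prb :=
  ⟨p * q, mul_pos p.2.1 q.2.1, mul_lt_one_of_nonneg_of_lt_one_left p.2.1.le p.2.2 q.2.2.le⟩

/-- `(1 - p) * q / (1 - p * q)`. -/
noncomputable def assoc (p q : Prb) : Prb :=
  ⟨(1 - p) * q / (1 - p * q), by
    have hp0 := p.2.1
    have hp1 := p.2.2
    have hq0 := q.2.1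
    have hq1 := q.2.2
    have hpq : (p : ℝ) * q < 1 := (mul p q).2.2
    constructor
    · exact div_pos (mul_pos (by linarith) hq0) (by linarith)
    · rw [div_lt_one (by linarith)]
      linarith⟩

end Prb

open PCSP in
/-- The common equations, as pairs (left-hand side, right-hand side). -/
inductive CommonEq {Act : Type*} : PCSP Act → PCSP Act → Prop
  | p1 (p : Prb) (P) : CommonEq (prob p P P) P
  | p2 (p : Prb) (P Q) : CommonEq (prob p P Q) (prob p.compl Q P)
  | p3 (p q : Prb) (P Q R) :
      CommonEq (prob q (prob p P Q) R) (prob (p.mul q) P (prob (p.assoc q) Q R))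
  | i1 (P) : CommonEq (int P P) P
  | i2 (P Q) : CommonEq (int P Q) (int Q P)
  | i3 (P Q R) : CommonEq (int (int P Q) R) (int P (int Q R))
  | e1 (P) : CommonEq (ext P nil) P
  | e2 (P Q) : CommonEq (ext P Q) (ext Q P)
  | e3 (P Q R) : CommonEq (ext (ext P Q) R) (ext P (ext Q R))
  | ei (a : Act) (P Q) : CommonEq (ext (pre a P) (pre a Q)) (int (pre a P) (pre a Q))
  | d1 (p : Prb) (P Q R) : CommonEq (ext P (prob p Q R)) (prob p (ext P Q) (ext P R))
  | d2 (a : Act) (P Q R) :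
      CommonEq (ext (pre a P) (int Q R)) (int (ext (pre a P) Q) (ext (pre a P) R))
  | d3 (P₁ P₂ Q₁ Q₂) :
      CommonEq (ext (int P₁ P₂) (int Q₁ Q₂))
        (int (int (int (ext P₁ (int Q₁ Q₂)) (ext P₂ (int Q₁ Q₂)))
          (ext (int P₁ P₂) Q₁)) (ext (int P₁ P₂) Q₂))

open PCSP in
/-- The axioms `P ⊑ Q` of the may theory: the common equations, read in both directions, and
the four may inequations, of which the first is an equation. -/
inductive MayAxiom {Act : Type*} : PCSP Act → PCSP Act → Prop
  | eq {P Q} : CommonEq P Q → MayAxiom P Q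
  | eq_symm {P Q} : CommonEq P Q → MayAxiom Q P
  | may0 (a b : Act) (P Q) :
      MayAxiom (ext (pre a P) (pre b Q)) (int (pre a P) (pre b Q))
  | may0_symm (a b : Act) (P Q) :
      MayAxiom (int (pre a P) (pre b Q)) (ext (pre a P) (pre b Q))
  | may1 (P Q) : MayAxiom P (int P Q)
  | may2 (P) : MayAxiom nil P
  | may3 (a : Act) (p : Prb) (P Q) :
      MayAxiom (pre a (prob p P Q)) (prob p (pre a P) (pre a Q))

open PCSP in
/-- The axioms `P ⊑ Q` of the must theory: the common equations, read in both directions, and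
the two must inequations. The second one is the schema
`R ⊓ ⨅ i, ⨁ j, p i j · (a i . Q i j □ P i j) ⊑ □ i, a i . ⨁ j, p i j · Q i j`
for finite families, with `j` ranging over a nonempty index set `Fin (m i + 1)` that depends
on `i`, provided that the initial actions of `R` are among the `a i`. -/
inductive MustAxiom {Act : Type*} : PCSP Act → PCSP Act → Prop
  | eq {P Q} : CommonEq P Q → MustAxiom P Q
  | eq_symm {P Q} : CommonEq P Q → MustAxiom Q P
  | must1 (P Q) : MustAxiom (int P Q) Q
  | must2 (R : PCSP Act) (n : ℕ) (a : Fin n → Act) (m : Fin n → ℕ)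
      (p : ∀ i, Fin (m i + 1) → ℝ) (p_pos : ∀ i j, 0 < p i j) (p_sum : ∀ i, ∑ j, p i j = 1)
      (Q P : ∀ i, Fin (m i + 1) → PCSP Act)
      (inits_subset : R.inits ⊆ Set.range fun i => (some (a i) : Label Act)) :
      MustAxiom
        (intFamily R n fun i =>
          bigProb (m i) (p i) (p_pos i) fun j => ext (pre (a i) (Q i j)) (P i j))
        (bigExt n fun i => pre (a i) (bigProb (m i) (p i) (p_pos i) (Q i)))

open PCSP in
/-- `P ⊑ Q` is derivable within nCSP from the axioms `Ax`: the least relation on nCSP that contains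
the instances of the axioms in nCSP, and is reflexive, transitive and closed under the operators
of nCSP. -/
inductive Derivable {Act : Type*} (Ax : PCSP Act → PCSP Act → Prop) : PCSP Act → PCSP Act → Prop
  | ax {P Q} : P ∈ nCSP Act → Q ∈ nCSP Act → Ax P Q → Derivable Ax P Q
  | refl {P} : P ∈ nCSP Act → Derivable Ax P P
  | trans {P Q R} : Derivable Ax P Q → Derivable Ax Q R → Derivable Ax P R
  | pre (a : Act) {P Q} : Derivable Ax P Q → Derivable Ax (pre a P) (pre a Q)
  | int {P P' Q Q'} : Derivable Ax P P' → Derivable Ax Q Q' → Derivable Ax (int P Q) (int P' Q')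
  | ext {P P' Q Q'} : Derivable Ax P P' → Derivable Ax Q Q' → Derivable Ax (ext P Q) (ext P' Q')
  | prob (p : Prb) {P P' Q Q'} :
      Derivable Ax P P' → Derivable Ax Q Q' → Derivable Ax (prob p P Q) (prob p P' Q')

/-- `P ⊑ Q` is derivable in the may theory. -/
def MayDerivable {Act : Type*} (P Q : PCSP Act) : Prop := Derivable MayAxiom P Q

/-- `P ⊑ Q` is derivable in the must theory. -/
def MustDerivable {Act : Type*} (P Q : PCSP Act) : Prop := Derivable MustAxiom P Q

-- Both equivalences have the same shape and are largely proved together. The proposition `b` in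
-- `GenBy b` and `GenLE b` switches the refusal clause on or off, so `GenLE False` is the simulation
-- preorder and `GenLE True` is the failure simulation preorder with its arguments swapped. On the
-- syntactic side, the may theory and the opposite of the must theory are both instances of
-- `ChoiceTheory`: precongruences satisfying the common equations in which ⊓ is a join.
--
-- Soundness: `GenLE b` is a preorder, because weak moves can be tracked through a lifted simulation
-- (`lift_genBy_weak`, `GenBy.trans`). It is closed under convex combinations and under the
-- operators, the main case being `GenBy.ext`. Each axiom is then checked by one round of the
-- simulation game.
--
-- Completeness needs a passage from distributions back to terms. By P1-P3, terms with equal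
-- denotations are provably equal (`ChoiceTheory.of_den_eq`): provable classes form a barycentric
-- algebra, which sits inside a commutative monoid, its cone, where nested choices become finite
-- sums determined by the denotation. The theory thus induces an order `DistLE` on distributions, in
-- which τ moves go down.
--
-- The core is an induction on the height of the simulated state s (`ChoiceTheory.distLE_of_genBy`).
-- By `ChoiceTheory.head_normal_form`, s is either below an internal choice of its τ-derivatives or
-- provably an external choice of prefixes. In the first case each derivative is matched by a weak
-- derivative of Θ, hence is below Θ by induction, and so is their join. In the second case the may
-- and must theories part ways. In the may theory, May0 and May2 make an external choice of prefixes
-- a join, and May3 puts each prefix below the distribution performing the matching action. In the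
-- must theory, the data of a failure simulation are those of Must2: R is the derivative of Θ that
-- matches the refusals of s, and the i-th probabilistic sum is the derivative about to perform the
-- i-th action.

-- Finitely supported distributions and biconvex relations

/-- A relation between distributions that is closed under binary convex combinations. -/
def BiConvex {S T : Type*} (C : FDist S → FDist T → Prop) : Prop :=
  ∀ (a b : ℝ) (ha : 0 ≤ a) (hb : 0 ≤ b) (hab : a + b = 1) (Δ₁ Δ₂ : FDist S) (Θ₁ Θ₂ : FDist T),
    C Δ₁ Θ₁ → C Δ₂ Θ₂ →
      C (convexCombPair a b ha hb hab Δ₁ Δ₂) (convexCombPair a b ha hb hab Θ₁ Θ₂)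

/-- The related pairs form a convex subset of the product of the two spaces of distributions, and
such a set contains all finite convex combinations of its points. -/
theorem BiConvex.iConvexComb {S T I : Type*} {C : FDist S → FDist T → Prop} (hC : BiConvex C)
    (p : FDist I) (f : I → FDist S) (g : I → FDist T)
    (h : ∀ i, p.weights i ≠ 0 → C (f i) (g i)) :
    C (p.iConvexComb f) (p.iConvexComb g) := by
  have hs : IsConvexSet ℝ {x : FDist S × FDist T | C x.1 x.2} := by
    refine IsConvexSet.of_convexCombPair_mem ?_
    intro a b ha hb hab x hx y hy
    simpa using hC a b ha hb hab _ _ _ _ hx hy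
  have := hs.iConvexComb_mem (w := p) (f := fun i => (f i, g i)) h
  simpa using this

theorem iConvexComb_convexCombPair_left {I M : Type*} [ConvexSpace ℝ M] (a b : ℝ) (ha : 0 ≤ a)
    (hb : 0 ≤ b) (hab : a + b = 1) (p q : FDist I) (f : I → M) :
    (convexCombPair a b ha hb hab p q).iConvexComb f =
      convexCombPair a b ha hb hab (p.iConvexComb f) (q.iConvexComb f) := by
  unfold StdSimplex.iConvexComb
  rw [(StdSimplex.isAffineMap_map ℝ f).map_convexCombPair, sConvexComb_convexCombPair]

theorem weights_iConvexComb_fdist {I S : Type*} (p : FDist I) (f : I → FDist S) :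
    (p.iConvexComb f).weights = p.weights.sum fun i r => r • (f i).weights := by
  simp [StdSimplex.iConvexComb, Finsupp.sum_mapDomain_index, add_smul]

theorem iConvexComb_single_fun {S : Type*} (Δ : FDist S) :
    Δ.iConvexComb (fun s => (StdSimplex.single s : FDist S)) = Δ := by
  ext x
  simp

theorem iConvexComb_single_comp {I S : Type*} (p : FDist I) (s : I → S) :
    p.iConvexComb (fun i => (StdSimplex.single (s i) : FDist S)) = p.map s := by
  rw [← iConvexComb_map p s (fun x => (StdSimplex.single x : FDist S)), iConvexComb_single_fun]

/-- Enumerating the support gives an index set of the form required by `Lift`. Positivity of all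
weights matters for `PCSP.bigProb`, which admits no zero weights. -/
theorem exists_map_fin {I : Type*} (p : FDist I) :
    ∃ (n : ℕ) (q : FDist (Fin n)) (e : Fin n → I),
      q.map e = p ∧ (∀ k, p.weights (e k) ≠ 0) ∧ ∀ k, 0 < q.weights k := by
  classical
  let e := p.weights.support.equivFin.symm
  have hinj : Function.Injective fun k => (e k : I) := fun i j h => e.injective (Subtype.ext h)
  have hsum : ∑ k, p.weights (e k) = 1 := by
    rw [e.sum_comp (fun x => p.weights x), ← p.total, Finsupp.sum]
    exact Finset.sum_coe_sort _ _
  refine ⟨_, ⟨Finsupp.equivFunOnFinite.symm fun k => p.weights (e k), ?_, ?_⟩, fun k => e k, ?_, ?_, ?_⟩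
  · intro k; simp
  · rw [Finsupp.sum_fintype _ _ (fun _ => rfl)]; simpa using hsum
  · ext x
    rw [StdSimplex.weights_map]
    by_cases hx : ∃ k, (e k : I) = x
    · obtain ⟨k, rfl⟩ := hx
      rw [Finsupp.mapDomain_apply hinj]; simp
    · rw [Finsupp.mapDomain_of_notMem_range _ _ (by simpa using hx)]
      by_contra h
      exact hx ⟨e.symm ⟨x, by simpa using Ne.symm h⟩, by simp⟩
  · exact fun k => Finsupp.mem_support_iff.1 (e k).2
  · intro k
    exact lt_of_le_of_ne (p.weights_nonneg _) (Finsupp.mem_support_iff.1 (e k).2).symm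

-- Lifting relations from states to distributions

theorem Lift.of_iConvexComb {S I : Type*} {R : S → FDist S → Prop} (p : FDist I) (s : I → S)
    (Φ : I → FDist S) (h : ∀ i, p.weights i ≠ 0 → R (s i) (Φ i)) :
    Lift R (p.map s) (p.iConvexComb Φ) := by
  obtain ⟨n, q, e, rfl, he, -⟩ := exists_map_fin p
  refine ⟨n, q, fun k => s (e k), fun k => Φ (e k), ?_, fun k => h _ (he k), ?_⟩
  · rw [iConvexComb_single_comp, StdSimplex.map_map]
  · rw [iConvexComb_map]

theorem Lift.single {S : Type*} {R : S → FDist S → Prop} {s : S} {Φ : FDist S} (h : R s Φ) :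
    Lift R (StdSimplex.single s) Φ := by
  have := Lift.of_iConvexComb (R := R) (StdSimplex.single ()) (fun _ => s) (fun _ => Φ)
    (fun _ _ => h)
  simpa using this

/-- The two decompositions are placed side by side over the disjoint union of their index sets. -/
theorem Lift.biConvex {S : Type*} (R : S → FDist S → Prop) : BiConvex (Lift R) := by
  rintro a b ha hb hab _ _ _ _ ⟨n, p, s, Φ, rfl, h, rfl⟩ ⟨m, q, t, Ψ, rfl, h', rfl⟩
  have := Lift.of_iConvexComb (R := R)
    (convexCombPair a b ha hb hab (p.map Sum.inl) (q.map Sum.inr)) (Sum.elim s t) (Sum.elim Φ Ψ)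
    (by rintro (i | i) _; exacts [h i, h' i])
  rw [← iConvexComb_single_comp] at this
  simpa [iConvexComb_convexCombPair_left] using this

/-- With `Lift.biConvex`, this says that the lifting is the least biconvex relation containing the
generating pairs. Most facts about lifted relations are reduced to single states in this way. -/
theorem Lift.induction {S : Type*} {R : S → FDist S → Prop} {C : FDist S → FDist S → Prop}
    (hC : BiConvex C) (h : ∀ s Φ, R s Φ → C (StdSimplex.single s) Φ) {Δ Θ : FDist S}
    (hl : Lift R Δ Θ) : C Δ Θ := by
  obtain ⟨n, p, s, Φ, rfl, hR, rfl⟩ := hl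
  exact hC.iConvexComb _ _ _ fun i _ => h _ _ (hR i)

theorem weights_map_ne_zero {I S : Type*} (p : FDist I) (s : I → S) {i : I}
    (hi : p.weights i ≠ 0) : (p.map s).weights (s i) ≠ 0 := by
  classical
  rw [StdSimplex.weights_map, Finsupp.mapDomain, Finsupp.sum_apply, Finsupp.sum]
  refine (Finset.sum_pos' (fun j _ => ?_) ⟨i, by simpa using hi, ?_⟩).ne'
  · rw [Finsupp.single_apply]; split_ifs <;> simp
  · simpa using lt_of_le_of_ne (p.weights_nonneg i) hi.symm

theorem exists_of_weights_map_ne_zero {I S : Type*} (p : FDist I) (s : I → S) {x : S}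
    (hx : (p.map s).weights x ≠ 0) : ∃ i, p.weights i ≠ 0 ∧ s i = x := by
  classical
  have := Finsupp.mapDomain_support (f := s) (s := p.weights) (Finsupp.mem_support_iff.2 hx)
  simpa using this

open Classical in
/-- Conditioning `p` on the fibres of `s` disintegrates it. -/
theorem disintegrate {I S : Type*} [Nonempty S] (p : FDist I) (s : I → S) :
    ∃ k : S → FDist I, (∀ x i, (p.map s).weights x ≠ 0 → (k x).weights i ≠ 0 → s i = x) ∧
      (∀ x i, (p.map s).weights x ≠ 0 → (k x).weights i ≠ 0 → p.weights i ≠ 0) ∧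
      (p.map s).iConvexComb k = p := by
  have hex : ∀ x, (p.map s).weights x ≠ 0 → ∃ i ∈ {i | s i = x}, p.weights i ≠ 0 := by
    intro x hx
    obtain ⟨i, hi, h⟩ := exists_of_weights_map_ne_zero p s hx
    exact ⟨i, h, hi⟩
  -- The value `p` off the support of the pushforward is an arbitrary default.
  refine ⟨fun x => if hx : (p.map s).weights x ≠ 0 then p.restrict {i | s i = x} (hex x hx) else p,
    ?_, ?_, ?_⟩
  · intro x i hx hi
    simp only [dif_pos hx] at hi
    rw [← Finsupp.mem_support_iff, StdSimplex.support_weights_restrict] at hi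
    simpa using (Finset.mem_filter.1 hi).2
  · intro x i hx hi
    simp only [dif_pos hx] at hi
    rw [← Finsupp.mem_support_iff, StdSimplex.support_weights_restrict] at hi
    simpa using (Finset.mem_filter.1 hi).1
  · ext i
    rw [weights_iConvexComb_fdist, Finsupp.sum_apply, Finsupp.sum,
      Finset.sum_eq_single (s i)]
    · by_cases hi : p.weights i = 0
      · rw [hi]
        split_ifs <;> simp [StdSimplex.weights_restrict, hi]
      · have hx := weights_map_ne_zero p s hi
        rw [dif_pos hx, StdSimplex.weights_restrict]
        -- The normalizing constant of the conditioned distribution is the mass of the fibre, so it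
        -- cancels against the pushforward weight.
        have : (p.weights.filter (· ∈ {j | s j = s i})).sum (fun _ k => k) =
            (p.map s).weights (s i) := by
          rw [StdSimplex.weights_map, Finsupp.mapDomain, Finsupp.sum_apply, Finsupp.sum,
            Finsupp.sum, Finsupp.support_filter, Finset.sum_filter]
          refine Finset.sum_congr rfl fun j _ => ?_
          by_cases hj : s j = s i <;> simp [hj]
        rw [this]
        simp
        rw [StdSimplex.weights_map] at hx
        field_simp
    · intro x hx hne
      have hx' : (p.map s).weights x ≠ 0 := by simpa using hx
      rw [dif_pos hx', StdSimplex.weights_restrict]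
      simp [Ne.symm hne]
    · intro h
      simp only [Finsupp.notMem_support_iff.1 h, zero_smul, Finsupp.coe_zero, Pi.zero_apply]

/-- A lifted relation is given by a kernel. -/
theorem lift_iff {S : Type*} {R : S → FDist S → Prop} {Δ Θ : FDist S} :
    Lift R Δ Θ ↔ ∃ f : S → FDist S,
      (∀ s, Δ.weights s ≠ 0 → Lift R (StdSimplex.single s) (f s)) ∧ Θ = Δ.iConvexComb f := by
  constructor
  · rintro ⟨n, p, s, Φ, rfl, hR, rfl⟩
    rw [iConvexComb_single_comp]
    have : Nonempty S := p.nonempty.map s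
    obtain ⟨k, hk, hk', hp⟩ := disintegrate p s
    -- The kernel averages the `Φ i` over the fibre of `x`. The average need not be an `R`-image of
    -- `x` itself, only a convex combination of such images.
    refine ⟨fun x => (k x).iConvexComb Φ, fun x hx => ?_, ?_⟩
    · have := Lift.of_iConvexComb (R := R) (k x) s Φ (fun i _ => hR i)
      rwa [← iConvexComb_single_comp, iConvexComb_congr
        (g := fun _ => (StdSimplex.single x : FDist S)) (fun i hi => by rw [hk x i hx hi]),
        iConvexComb_const] at this
    · rw [iConvexComb_assoc, hp]
  · rintro ⟨f, hf, rfl⟩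
    have := (Lift.biConvex R).iConvexComb Δ (fun s => StdSimplex.single s) f hf
    rwa [iConvexComb_single_fun] at this

/-- One kernel for the mixture serves every component of nonzero weight, since the support of such a
component lies in that of the mixture. -/
theorem Lift.split {S I : Type*} {R : S → FDist S → Prop} {p : FDist I} {D : I → FDist S}
    {Θ : FDist S} (h : Lift R (p.iConvexComb D) Θ) :
    ∃ T : I → FDist S, (∀ i, p.weights i ≠ 0 → Lift R (D i) (T i)) ∧ Θ = p.iConvexComb T := by
  classical
  obtain ⟨f, hf, rfl⟩ := lift_iff.1 h
  refine ⟨fun i => (D i).iConvexComb f, fun i hi => lift_iff.2 ⟨f, fun s hs => hf s ?_, rfl⟩, ?_⟩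
  · rw [weights_iConvexComb_fdist, Finsupp.sum_apply, Finsupp.sum]
    refine (Finset.sum_pos' (fun j _ => ?_) ⟨i, by simpa using hi, ?_⟩).ne'
    · exact mul_nonneg (p.weights_nonneg j) ((D j).weights_nonneg s)
    · exact mul_pos (lt_of_le_of_ne (p.weights_nonneg i) hi.symm)
        (lt_of_le_of_ne ((D i).weights_nonneg s) hs.symm)
  · rw [iConvexComb_assoc]

theorem Lift.mono {S : Type*} {R R' : S → FDist S → Prop} (h : ∀ s Φ, R s Φ → R' s Φ)
    {Δ Θ : FDist S} (hl : Lift R Δ Θ) : Lift R' Δ Θ :=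
  let ⟨n, p, s, Φ, h₁, h₂, h₃⟩ := hl
  ⟨n, p, s, Φ, h₁, fun i => h _ _ (h₂ i), h₃⟩

theorem Lift.refl {S : Type*} {R : S → FDist S → Prop} (Δ : FDist S)
    (h : ∀ s, Δ.weights s ≠ 0 → R s (StdSimplex.single s)) : Lift R Δ Δ :=
  lift_iff.2 ⟨fun s => StdSimplex.single s, fun s hs => Lift.single (h s hs),
    (iConvexComb_single_fun Δ).symm⟩

/-- Convexity induction for liftings out of a point distribution. -/
theorem Lift.single_induction {S : Type*} {R : S → FDist S → Prop} {s : S}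
    {C : FDist S → Prop} (hC : ∀ (a b : ℝ) (ha : 0 ≤ a) (hb : 0 ≤ b) (hab : a + b = 1) Θ₁ Θ₂,
      C Θ₁ → C Θ₂ → C (convexCombPair a b ha hb hab Θ₁ Θ₂))
    (h : ∀ Φ, R s Φ → C Φ) {Θ : FDist S} (hl : Lift R (StdSimplex.single s) Θ) : C Θ := by
  obtain ⟨n, p, t, Φ, hs, hR, rfl⟩ := hl
  rw [iConvexComb_single_comp] at hs
  have ht : ∀ i, p.weights i ≠ 0 → t i = s := by
    intro i hi
    have := weights_map_ne_zero p t hi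
    rw [← hs] at this
    by_contra hne
    simp [Ne.symm hne] at this
  have hconv : IsConvexSet ℝ {Θ | C Θ} :=
    IsConvexSet.of_convexCombPair_mem fun a b ha hb hab x hx y hy => hC a b ha hb hab x y hx hy
  exact hconv.iConvexComb_mem fun i hi => h _ (ht i hi ▸ hR i)

/-- If single moves along `A` out of `R`-related states are answered by `B`, then so are lifted
moves out of `Lift R`-related distributions. -/
theorem Lift.track {S : Type*} {R A : S → FDist S → Prop} {B : FDist S → FDist S → Prop}
    (hB : BiConvex B)
    (h : ∀ s Θ Δ', R s Θ → A s Δ' → ∃ Θ', B Θ Θ' ∧ Lift R Δ' Θ') {Δ Θ Δ' : FDist S}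
    (hR : Lift R Δ Θ) (hA : Lift A Δ Δ') : ∃ Θ', B Θ Θ' ∧ Lift R Δ' Θ' := by
  have hC : BiConvex fun Δ' Θ => ∃ Θ', B Θ Θ' ∧ Lift R Δ' Θ' := by
    rintro a b ha hb hab Δ₁ Δ₂ Θ₁ Θ₂ ⟨Ψ₁, h₁, h₁'⟩ ⟨Ψ₂, h₂, h₂'⟩
    exact ⟨_, hB a b ha hb hab _ _ _ _ h₁ h₂, Lift.biConvex R a b ha hb hab _ _ _ _ h₁' h₂'⟩
  obtain ⟨f, hf, rfl⟩ := lift_iff.1 hR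
  obtain ⟨g, hg, rfl⟩ := lift_iff.1 hA
  refine hC.iConvexComb Δ g f fun s hs => ?_
  -- At a fixed state, both kernels give convex combinations of genuine images. Biconvexity of the
  -- goal removes one combination at a time, first for `A` and then for `R`.
  refine Lift.single_induction (R := A) (C := fun G => ∃ Θ', B (f s) Θ' ∧ Lift R G Θ') ?_ ?_
    (hg s hs)
  · intro a b ha hb hab G₁ G₂ h₁ h₂
    simpa using hC a b ha hb hab _ _ _ _ h₁ h₂
  intro G hG
  refine Lift.single_induction (R := R) (C := fun F => ∃ Θ', B F Θ' ∧ Lift R G Θ') ?_ ?_ (hf s hs)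
  · intro a b ha hb hab G₁ G₂ h₁ h₂
    simpa using hC a b ha hb hab _ _ _ _ h₁ h₂
  exact fun F hF => h s F G hF hG

/-- The second lifting is split along the decomposition that witnesses the first. This is the form
needed for composing simulations. -/
theorem Lift.comp {S : Type*} {A B : S → FDist S → Prop} {Δ Θ Φ : FDist S} (hA : Lift A Δ Θ)
    (hB : Lift B Θ Φ) : Lift (fun s Φ => ∃ Θ, A s Θ ∧ Lift B Θ Φ) Δ Φ := by
  obtain ⟨n, p, s, Ψ, rfl, hR, rfl⟩ := hA
  obtain ⟨T, hT, rfl⟩ := hB.split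
  rw [iConvexComb_single_comp]
  exact Lift.of_iConvexComb p s T fun i hi => ⟨_, hR i, hT i hi⟩

theorem Lift.map_map {S T : Type*} {R : T → FDist T → Prop} (Δ : FDist S) (f g : S → T)
    (h : ∀ s, R (f s) (StdSimplex.single (g s))) : Lift R (Δ.map f) (Δ.map g) := by
  rw [← iConvexComb_single_comp Δ g]
  exact Lift.of_iConvexComb Δ f _ fun s _ => h s

/-! ## Weak transitions -/

section Weak

variable {Act : Type*}

theorem weights_convexCombPair_ne_zero {S : Type*} {a b : ℝ} {ha : 0 ≤ a} {hb : 0 ≤ b}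
    {hab : a + b = 1} {Δ Θ : FDist S} {s : S}
    (h : (convexCombPair a b ha hb hab Δ Θ).weights s ≠ 0) :
    Δ.weights s ≠ 0 ∨ Θ.weights s ≠ 0 := by
  by_contra! hc
  simp [hc.1, hc.2] at h

theorem lift_hatTau_refl (Δ : FDist (SCSP Act)) : Lift HatTau Δ Δ :=
  Lift.refl Δ fun _ _ => Or.inr rfl

theorem WeakTau.refl (Δ : FDist (SCSP Act)) : WeakTau Δ Δ := Relation.ReflTransGen.refl

theorem WeakTau.trans {Δ Θ Φ : FDist (SCSP Act)} (h : WeakTau Δ Θ) (h' : WeakTau Θ Φ) :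
    WeakTau Δ Φ := Relation.ReflTransGen.trans h h'

theorem WeakTau.of_step {s : SCSP Act} {Δ : FDist (SCSP Act)} (h : Step s none Δ) :
    WeakTau (StdSimplex.single s) Δ :=
  Relation.ReflTransGen.single (Lift.single (Or.inl h))

/-- Computations of different lengths are run one after the other: while one component moves the
other idles, which the reflexive part of `HatTau` permits. -/
theorem WeakTau.biConvex : BiConvex (WeakTau (Act := Act)) := by
  intro a b ha hb hab Δ₁ Δ₂ Θ₁ Θ₂ h₁ h₂
  refine Relation.ReflTransGen.trans (b := convexCombPair a b ha hb hab Θ₁ Δ₂) ?_ ?_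
  · induction h₁ with
    | refl => exact Relation.ReflTransGen.refl
    | tail _ h ih =>
      exact ih.tail (Lift.biConvex _ a b ha hb hab _ _ _ _ h (lift_hatTau_refl _))
  · induction h₂ with
    | refl => exact Relation.ReflTransGen.refl
    | tail _ h ih =>
      exact ih.tail (Lift.biConvex _ a b ha hb hab _ _ _ _ (lift_hatTau_refl _) h)

theorem Weak.biConvex (α : Label Act) : BiConvex (Weak α) := by
  cases α with
  | none => exact WeakTau.biConvex
  | some x =>
    rintro a b ha hb hab _ _ _ _ ⟨Δ, Δ', h₁, h₂, h₃⟩ ⟨Θ, Θ', h₁', h₂', h₃'⟩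
    exact ⟨_, _, WeakTau.biConvex a b ha hb hab _ _ _ _ h₁ h₁',
      Lift.biConvex _ a b ha hb hab _ _ _ _ h₂ h₂', WeakTau.biConvex a b ha hb hab _ _ _ _ h₃ h₃'⟩

theorem Weak.of_step {α : Label Act} {s : SCSP Act} {Δ : FDist (SCSP Act)} (h : Step s α Δ) :
    Weak α (StdSimplex.single s) Δ := by
  cases α with
  | none => exact WeakTau.of_step h
  | some a => exact ⟨_, _, WeakTau.refl _, Lift.single h, WeakTau.refl _⟩

theorem Weak.trans_left {α : Label Act} {Δ Θ Φ : FDist (SCSP Act)} (h : WeakTau Δ Θ)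
    (h' : Weak α Θ Φ) : Weak α Δ Φ := by
  cases α with
  | none => exact h.trans h'
  | some a =>
    obtain ⟨_, _, h₁, h₂, h₃⟩ := h'
    exact ⟨_, _, h.trans h₁, h₂, h₃⟩

theorem RefusesDist.convexCombPair {X : Set Act} {Δ Θ : FDist (SCSP Act)} (h : RefusesDist Δ X)
    (h' : RefusesDist Θ X) (a b : ℝ) (ha : 0 ≤ a) (hb : 0 ≤ b) (hab : a + b = 1) :
    RefusesDist (convexCombPair a b ha hb hab Δ Θ) X := by
  intro s hs
  rcases weights_convexCombPair_ne_zero (Finsupp.mem_support_iff.1 hs) with h₁ | h₁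
  · exact h s (Finsupp.mem_support_iff.2 h₁)
  · exact h' s (Finsupp.mem_support_iff.2 h₁)

theorem refusesDist_single {X : Set Act} {s : SCSP Act} (h : s.Refuses X) :
    RefusesDist (StdSimplex.single s) X := by
  intro t ht
  obtain rfl : t = s := by simpa using ht
  exact h

end Weak

/-! ## Simulations and failure simulations, uniformly

The proposition `b` decides whether refusals have to be matched. -/

section GenSim

variable {Act : Type*}

/-- A simulation which, if `b` holds, is a failure simulation. -/
def IsGenSim (b : Prop) (R : SCSP Act → FDist (SCSP Act) → Prop) : Prop :=
  (∀ s Θ, R s Θ → ∀ α Δ, Step s α Δ → ∃ Θ', Weak α Θ Θ' ∧ Lift R Δ Θ') ∧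
  (b → ∀ s Θ, R s Θ → ∀ X : Set Act, s.Refuses X → ∃ Θ', WeakTau Θ Θ' ∧ RefusesDist Θ' X)

/-- The union of all (failure) simulations. -/
def GenBy (b : Prop) (s : SCSP Act) (Θ : FDist (SCSP Act)) : Prop := ∃ R, IsGenSim b R ∧ R s Θ

/-- The (failure) simulation preorder between distributions. -/
def GenLE (b : Prop) (Δ Θ : FDist (SCSP Act)) : Prop :=
  ∃ Θ', WeakTau Θ Θ' ∧ Lift (GenBy b) Δ Θ'

theorem genBy_false : GenBy (Act := Act) False = SimBy := by
  ext s Θ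
  exact ⟨fun ⟨R, h, h'⟩ => ⟨R, h.1, h'⟩, fun ⟨R, h, h'⟩ => ⟨R, ⟨h, False.elim⟩, h'⟩⟩

theorem genBy_true : GenBy (Act := Act) True = FailSimBy := by
  ext s Θ
  exact ⟨fun ⟨R, h, h'⟩ => ⟨R, ⟨h.1, h.2 trivial⟩, h'⟩,
    fun ⟨R, h, h'⟩ => ⟨R, ⟨h.1, fun _ => h.2⟩, h'⟩⟩

variable {b : Prop}

theorem GenBy.step {s : SCSP Act} {Θ Δ : FDist (SCSP Act)} {α : Label Act} (h : GenBy b s Θ)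
    (hs : Step s α Δ) : ∃ Θ', Weak α Θ Θ' ∧ Lift (GenBy b) Δ Θ' := by
  obtain ⟨R, hR, h⟩ := h
  obtain ⟨Θ', h₁, h₂⟩ := hR.1 _ _ h _ _ hs
  exact ⟨Θ', h₁, h₂.mono fun _ _ h => ⟨R, hR, h⟩⟩

theorem GenBy.refuses {s : SCSP Act} {Θ : FDist (SCSP Act)} (h : GenBy b s Θ) (hb : b)
    {X : Set Act} (hs : s.Refuses X) : ∃ Θ', WeakTau Θ Θ' ∧ RefusesDist Θ' X := by
  obtain ⟨R, hR, h⟩ := h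
  exact hR.2 hb _ _ h _ hs

/-- The union of `R` with `GenBy b` is again a (failure) simulation. Successors may therefore leave
`R` as soon as they are known to be related by `GenBy b`. -/
theorem GenBy.coinduct (R : SCSP Act → FDist (SCSP Act) → Prop)
    (h₁ : ∀ s Θ, R s Θ → ∀ α Δ, Step s α Δ →
      ∃ Θ', Weak α Θ Θ' ∧ Lift (fun s Θ => R s Θ ∨ GenBy b s Θ) Δ Θ')
    (h₂ : b → ∀ s Θ, R s Θ → ∀ X : Set Act, s.Refuses X → ∃ Θ', WeakTau Θ Θ' ∧ RefusesDist Θ' X)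
    {s : SCSP Act} {Θ : FDist (SCSP Act)} (h : R s Θ) : GenBy b s Θ := by
  refine ⟨fun s Θ => R s Θ ∨ GenBy b s Θ, ⟨?_, ?_⟩, Or.inl h⟩
  · rintro s Θ (h | h) α Δ hs
    · exact h₁ s Θ h α Δ hs
    · obtain ⟨Θ', h, h'⟩ := h.step hs
      exact ⟨Θ', h, h'.mono fun _ _ => Or.inr⟩
  · rintro hb s Θ (h | h) X hX
    · exact h₂ hb s Θ h X hX
    · exact h.refuses hb hX

theorem GenBy.unfold {s : SCSP Act} {Θ : FDist (SCSP Act)}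
    (h₁ : ∀ α Δ, Step s α Δ → ∃ Θ', Weak α Θ Θ' ∧ Lift (GenBy b) Δ Θ')
    (h₂ : b → ∀ X : Set Act, s.Refuses X → ∃ Θ', WeakTau Θ Θ' ∧ RefusesDist Θ' X) :
    GenBy b s Θ := by
  refine GenBy.coinduct (fun s' Θ' => s' = s ∧ Θ' = Θ) ?_ ?_ ⟨rfl, rfl⟩
  · rintro _ _ ⟨rfl, rfl⟩ α Δ hs
    obtain ⟨Θ', h, h'⟩ := h₁ α Δ hs
    exact ⟨Θ', h, h'.mono fun _ _ => Or.inr⟩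
  · rintro hb _ _ ⟨rfl, rfl⟩ X hX
    exact h₂ hb X hX

theorem GenBy.refl (s : SCSP Act) : GenBy b s (StdSimplex.single s) := by
  refine GenBy.coinduct (fun s Θ => Θ = StdSimplex.single s) ?_ ?_ rfl
  · rintro s _ rfl α Δ hs
    exact ⟨Δ, Weak.of_step hs, Lift.refl _ fun _ _ => Or.inl rfl⟩
  · rintro _ s _ rfl X hX
    exact ⟨_, WeakTau.refl _, refusesDist_single hX⟩

theorem lift_genBy_refl (Δ : FDist (SCSP Act)) : Lift (GenBy b) Δ Δ :=
  Lift.refl _ fun s _ => GenBy.refl s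

/-- Each lifted step is answered through `Lift.track`, and an idle move is answered by idling. The
answers concatenate because they are weak. -/
theorem lift_genBy_weakTau {Δ Θ Δ' : FDist (SCSP Act)} (h : Lift (GenBy b) Δ Θ)
    (hw : WeakTau Δ Δ') : ∃ Θ', WeakTau Θ Θ' ∧ Lift (GenBy b) Δ' Θ' := by
  induction hw with
  | refl => exact ⟨Θ, WeakTau.refl _, h⟩
  | tail _ hs ih =>
    obtain ⟨Θ₁, h₁, h₂⟩ := ih
    obtain ⟨Θ₂, h₃, h₄⟩ := Lift.track WeakTau.biConvex (R := GenBy b) (A := HatTau) (by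
      rintro s Θ Δ' hg (hs | rfl)
      · exact hg.step hs
      · exact ⟨Θ, WeakTau.refl _, Lift.single hg⟩) h₂ hs
    exact ⟨Θ₂, h₁.trans h₃, h₄⟩

theorem lift_genBy_weak {α : Label Act} {Δ Θ Δ' : FDist (SCSP Act)} (h : Lift (GenBy b) Δ Θ)
    (hw : Weak α Δ Δ') : ∃ Θ', Weak α Θ Θ' ∧ Lift (GenBy b) Δ' Θ' := by
  cases α with
  | none => exact lift_genBy_weakTau h hw
  | some a =>
    obtain ⟨Δ₁, Δ₂, h₁, h₂, h₃⟩ := hw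
    obtain ⟨Θ₁, k₁, l₁⟩ := lift_genBy_weakTau h h₁
    obtain ⟨Θ₂, ⟨Ψ, Ψ', k₂, k₂', k₂''⟩, l₂⟩ := Lift.track (Weak.biConvex (some a))
      (A := fun s => Step s (some a)) (fun _ _ _ hg hs => GenBy.step hg hs) l₁ h₂
    obtain ⟨Θ₃, k₃, l₃⟩ := lift_genBy_weakTau l₂ h₃
    exact ⟨Θ₃, ⟨Ψ, Ψ', k₁.trans k₂, k₂', k₂''.trans k₃⟩, l₃⟩

theorem lift_genBy_refuses (hb : b) {X : Set Act} {Δ Θ : FDist (SCSP Act)}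
    (h : Lift (GenBy b) Δ Θ) (hX : RefusesDist Δ X) : ∃ Θ', WeakTau Θ Θ' ∧ RefusesDist Θ' X := by
  obtain ⟨f, hf, rfl⟩ := lift_iff.1 h
  have hC : BiConvex fun (_ : FDist (SCSP Act)) Θ => ∃ Θ', WeakTau Θ Θ' ∧ RefusesDist Θ' X := by
    rintro a b ha hb hab _ _ _ _ ⟨Θ₁, h₁, h₁'⟩ ⟨Θ₂, h₂, h₂'⟩
    exact ⟨_, WeakTau.biConvex a b ha hb hab _ _ _ _ h₁ h₂,
      h₁'.convexCombPair h₂' a b ha hb hab⟩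
  refine hC.iConvexComb Δ f f fun s hs => ?_
  refine Lift.single_induction (C := fun Θ => ∃ Θ', WeakTau Θ Θ' ∧ RefusesDist Θ' X)
    (fun a b ha hb hab Θ₁ Θ₂ h₁ h₂ => hC a b ha hb hab Δ Δ _ _ h₁ h₂) ?_ (hf s hs)
  exact fun Φ hΦ => hΦ.refuses hb (hX s (Finsupp.mem_support_iff.2 hs))

/-- The candidate simulation is the composite of `GenBy b` with its own lifting. The first game
answers with a weak move, so the second must track weak moves, not just single steps. -/
theorem GenBy.trans {s : SCSP Act} {Θ Φ : FDist (SCSP Act)} (h : GenBy b s Θ)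
    (h' : Lift (GenBy b) Θ Φ) : GenBy b s Φ := by
  refine GenBy.coinduct (fun s Φ => ∃ Θ, GenBy b s Θ ∧ Lift (GenBy b) Θ Φ) ?_ ?_ ⟨Θ, h, h'⟩
  · rintro s Φ ⟨Θ, h, h'⟩ α Δ hs
    obtain ⟨Θ', h₁, h₂⟩ := h.step hs
    obtain ⟨Φ', h₃, h₄⟩ := lift_genBy_weak h' h₁
    exact ⟨Φ', h₃, (h₂.comp h₄).mono fun _ _ => Or.inl⟩
  · rintro hb s Φ ⟨Θ, h, h'⟩ X hX
    obtain ⟨Θ', h₁, h₂⟩ := h.refuses hb hX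
    obtain ⟨Φ', h₃, h₄⟩ := lift_genBy_weakTau h' h₁
    obtain ⟨Φ'', h₅, h₆⟩ := lift_genBy_refuses hb h₄ h₂
    exact ⟨Φ'', h₃.trans h₅, h₆⟩

theorem GenLE.refl (Δ : FDist (SCSP Act)) : GenLE b Δ Δ :=
  ⟨Δ, WeakTau.refl _, lift_genBy_refl Δ⟩

theorem GenLE.of_weakTau {Δ Θ : FDist (SCSP Act)} (h : WeakTau Θ Δ) : GenLE b Δ Θ :=
  ⟨Δ, h, lift_genBy_refl Δ⟩

theorem GenLE.of_genBy {s : SCSP Act} {Θ : FDist (SCSP Act)} (h : GenBy b s Θ) :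
    GenLE b (StdSimplex.single s) Θ := ⟨Θ, WeakTau.refl _, Lift.single h⟩

theorem GenLE.trans {Δ Θ Φ : FDist (SCSP Act)} (h : GenLE b Δ Θ) (h' : GenLE b Θ Φ) :
    GenLE b Δ Φ := by
  obtain ⟨Θ', h₁, h₂⟩ := h
  obtain ⟨Φ', h₃, h₄⟩ := h'
  obtain ⟨Φ'', h₅, h₆⟩ := lift_genBy_weakTau h₄ h₁
  exact ⟨Φ'', h₃.trans h₅, (h₂.comp h₆).mono fun _ _ ⟨_, h, h'⟩ => h.trans h'⟩

theorem GenLE.biConvex : BiConvex (GenLE (Act := Act) b) := by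
  rintro a b ha hb hab _ _ _ _ ⟨_, h, h'⟩ ⟨_, k, k'⟩
  exact ⟨_, WeakTau.biConvex a b ha hb hab _ _ _ _ h k,
    Lift.biConvex _ a b ha hb hab _ _ _ _ h' k'⟩

/-! ## Internal choice is the join -/

theorem Step.int_iff {P Q : PCSP Act} {α : Label Act} {Δ : FDist (SCSP Act)} :
    Step (.int P Q) α Δ ↔ α = none ∧ (Δ = P.den ∨ Δ = Q.den) := by
  constructor
  · rintro (_ | _ | _) <;> simp
  · rintro ⟨rfl, rfl | rfl⟩
    · exact .int_l _ _
    · exact .int_r _ _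

theorem Step.not_refuses {s : SCSP Act} {Δ : FDist (SCSP Act)} (h : Step s none Δ) {X : Set Act} :
    ¬ s.Refuses X := fun hX => hX none (Set.mem_insert _ _) ⟨Δ, h⟩

/-- The two τ steps are the only transitions, and the definition of `GenLE` is exactly the condition
for matching each of them. The state is unstable, so it has no refusals to match. -/
theorem GenLE.int {P Q : PCSP Act} {Θ : FDist (SCSP Act)} (h : GenLE b P.den Θ)
    (h' : GenLE b Q.den Θ) : GenLE b (P.int Q).den Θ := by
  refine GenLE.of_genBy (GenBy.unfold ?_ ?_)
  · intro α Δ hs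
    obtain ⟨rfl, rfl | rfl⟩ := Step.int_iff.1 hs
    exacts [h, h']
  · exact fun _ X hX => ((Step.int_l P Q).not_refuses hX).elim

theorem GenLE.int_left (P Q : PCSP Act) : GenLE b P.den (P.int Q).den :=
  GenLE.of_weakTau (WeakTau.of_step (.int_l P Q))

theorem GenLE.int_right (P Q : PCSP Act) : GenLE b Q.den (P.int Q).den :=
  GenLE.of_weakTau (WeakTau.of_step (.int_r P Q))

/-! ## Prefixing -/

theorem Step.pre_iff {a : Act} {P : PCSP Act} {α : Label Act} {Δ : FDist (SCSP Act)} :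
    Step (.pre a P) α Δ ↔ α = some a ∧ Δ = P.den := by
  constructor
  · rintro (_ | _); simp
  · rintro ⟨rfl, rfl⟩; exact .action _ _

theorem Step.not_nil {α : Label Act} {Δ : FDist (SCSP Act)} : ¬ Step .nil α Δ := nofun

theorem SCSP.refuses_pre {a : Act} {P : PCSP Act} {X : Set Act} :
    (SCSP.pre a P).Refuses X ↔ a ∉ X := by
  constructor
  · intro h ha
    exact h (some a) (Or.inr ⟨a, ha, rfl⟩) ⟨_, .action a P⟩
  · rintro h _ (rfl | ⟨x, hx, rfl⟩) ⟨Δ, hs⟩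
    · simpa using (Step.pre_iff.1 hs).1
    · have := (Step.pre_iff.1 hs).1
      simp only [Option.some.injEq] at this
      exact h (this ▸ hx)

/-- A prefix is below every distribution that can match its action and is able to refuse
what the prefix refuses. -/
theorem GenLE.pre_le {a : Act} {P : PCSP Act} {Θ Θ' : FDist (SCSP Act)}
    (h : Weak (some a) Θ Θ') (h' : Lift (GenBy b) P.den Θ')
    (hr : b → ∀ X : Set Act, a ∉ X → ∃ Θ', WeakTau Θ Θ' ∧ RefusesDist Θ' X) :
    GenLE b (PCSP.pre a P).den Θ := by
  refine GenLE.of_genBy (GenBy.unfold ?_ ?_)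
  · intro α Δ hs
    obtain ⟨rfl, rfl⟩ := Step.pre_iff.1 hs
    exact ⟨Θ', h, h'⟩
  · exact fun hb X hX => hr hb X (SCSP.refuses_pre.1 hX)

theorem GenLE.pre (a : Act) {P Q : PCSP Act} (h : GenLE b P.den Q.den) :
    GenLE b (PCSP.pre a P).den (PCSP.pre a Q).den := by
  obtain ⟨Θ, h₁, h₂⟩ := h
  exact GenLE.pre_le ⟨_, _, WeakTau.refl _, Lift.single (.action a Q), h₁⟩ h₂
    fun _ X hX => ⟨_, WeakTau.refl _, refusesDist_single (SCSP.refuses_pre.2 hX)⟩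

/-! ## External choice -/

/-- External choice, extended to distributions. -/
noncomputable def extDist (Δ Θ : FDist (SCSP Act)) : FDist (SCSP Act) :=
  Δ.iConvexComb fun s => Θ.map fun t => .ext s t

theorem extDist_eq (Δ Θ : FDist (SCSP Act)) : extDist Δ Θ =
    Δ.iConvexComb fun s => Θ.iConvexComb fun t => (StdSimplex.single (.ext s t) : FDist _) := by
  simp [extDist, iConvexComb_single_comp]

theorem extDist_eq_right (Δ Θ : FDist (SCSP Act)) :
    extDist Δ Θ = Θ.iConvexComb fun t => Δ.map fun s => .ext s t := by
  rw [extDist_eq, iConvexComb_comm]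
  simp [iConvexComb_single_comp]

theorem extDist_single_left (s : SCSP Act) (Θ : FDist (SCSP Act)) :
    extDist (StdSimplex.single s) Θ = Θ.map fun t => .ext s t := by simp [extDist]

theorem extDist_single_right (Δ : FDist (SCSP Act)) (t : SCSP Act) :
    extDist Δ (StdSimplex.single t) = Δ.map fun s => .ext s t := by simp [extDist_eq_right]

theorem extDist_pair_left (a b : ℝ) (ha : 0 ≤ a) (hb : 0 ≤ b) (hab : a + b = 1)
    (Δ₁ Δ₂ Θ : FDist (SCSP Act)) : extDist (convexCombPair a b ha hb hab Δ₁ Δ₂) Θ =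
      convexCombPair a b ha hb hab (extDist Δ₁ Θ) (extDist Δ₂ Θ) :=
  iConvexComb_convexCombPair_left ..

theorem extDist_pair_right (a b : ℝ) (ha : 0 ≤ a) (hb : 0 ≤ b) (hab : a + b = 1)
    (Δ Θ₁ Θ₂ : FDist (SCSP Act)) : extDist Δ (convexCombPair a b ha hb hab Θ₁ Θ₂) =
      convexCombPair a b ha hb hab (extDist Δ Θ₁) (extDist Δ Θ₂) := by
  simp only [extDist_eq_right]
  exact iConvexComb_convexCombPair_left ..

theorem PCSP.den_extState (P : PCSP Act) (t : SCSP Act) :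
    (P.extState t).den = P.den.map fun s => .ext s t := by
  match P with
  | .state s => simp [PCSP.extState, PCSP.den]
  | .prob p P Q =>
    rw [PCSP.extState, PCSP.den, PCSP.den, PCSP.den_extState P, PCSP.den_extState Q,
      (StdSimplex.isAffineMap_map ℝ _).map_convexCombPair]

/-- Distributing □ over the probabilistic choices of both arguments computes the bilinear extension
of □ to distributions. -/
theorem PCSP.den_ext (P Q : PCSP Act) : (P.ext Q).den = extDist P.den Q.den := by
  match Q with
  | .state t => rw [PCSP.ext, PCSP.den_extState, PCSP.den, extDist_single_right]
  | .prob p Q R => rw [PCSP.ext, PCSP.den, PCSP.den, PCSP.den_ext P Q, PCSP.den_ext P R,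
      extDist_pair_right]

theorem BiConvex.extDist_left {C : FDist (SCSP Act) → FDist (SCSP Act) → Prop} (hC : BiConvex C)
    (Φ Ψ : FDist (SCSP Act)) : BiConvex fun Δ Θ => C (extDist Δ Φ) (extDist Θ Ψ) := by
  intro a b ha hb hab Δ₁ Δ₂ Θ₁ Θ₂ h₁ h₂
  simp only [extDist_pair_left]
  exact hC a b ha hb hab _ _ _ _ h₁ h₂

theorem BiConvex.extDist_right {C : FDist (SCSP Act) → FDist (SCSP Act) → Prop} (hC : BiConvex C)
    (Φ Ψ : FDist (SCSP Act)) : BiConvex fun Δ Θ => C (extDist Φ Δ) (extDist Ψ Θ) := by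
  intro a b ha hb hab Δ₁ Δ₂ Θ₁ Θ₂ h₁ h₂
  simp only [extDist_pair_right]
  exact hC a b ha hb hab _ _ _ _ h₁ h₂

theorem lift_hatTau_ext_left {Θ Θ' : FDist (SCSP Act)} (h : Lift HatTau Θ Θ')
    (Φ : FDist (SCSP Act)) : Lift HatTau (extDist Θ Φ) (extDist Θ' Φ) := by
  refine Lift.induction (C := fun Θ Θ' => Lift HatTau (extDist Θ Φ) (extDist Θ' Φ))
    ((Lift.biConvex _).extDist_left Φ Φ) ?_ h
  rintro s Δ hs
  rw [extDist_single_left, extDist_eq_right]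
  refine Lift.of_iConvexComb _ _ _ fun t _ => ?_
  rcases hs with hs | rfl
  · exact Or.inl (.ext_i_l hs)
  · exact Or.inr (by simp)

theorem lift_hatTau_ext_right {Θ Θ' : FDist (SCSP Act)} (h : Lift HatTau Θ Θ')
    (Φ : FDist (SCSP Act)) : Lift HatTau (extDist Φ Θ) (extDist Φ Θ') := by
  refine Lift.induction (C := fun Θ Θ' => Lift HatTau (extDist Φ Θ) (extDist Φ Θ'))
    ((Lift.biConvex _).extDist_right Φ Φ) ?_ h
  rintro s Δ hs
  rw [extDist_single_right, extDist]
  refine Lift.of_iConvexComb _ _ _ fun t _ => ?_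
  rcases hs with hs | rfl
  · exact Or.inl (.ext_i_r hs)
  · exact Or.inr (by simp)

theorem WeakTau.ext {Θ Θ' Φ Φ' : FDist (SCSP Act)} (h : WeakTau Θ Θ') (h' : WeakTau Φ Φ') :
    WeakTau (extDist Θ Φ) (extDist Θ' Φ') := by
  refine WeakTau.trans (Θ := extDist Θ' Φ) ?_ ?_
  · exact Relation.ReflTransGen.lift (fun Θ => extDist Θ Φ)
      (fun _ _ h => lift_hatTau_ext_left h Φ) _ _ h
  · exact Relation.ReflTransGen.lift (fun Φ => extDist Θ' Φ)
      (fun _ _ h => lift_hatTau_ext_right h Θ') _ _ h'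

/-- A visible action resolves the choice, so the target does not depend on the state drawn from `Φ`,
and averaging over `Φ` leaves it unchanged. -/
theorem lift_step_ext_left {a : Act} {Θ Θ' : FDist (SCSP Act)}
    (h : Lift (fun s => Step s (some a)) Θ Θ') (Φ : FDist (SCSP Act)) :
    Lift (fun s => Step s (some a)) (extDist Θ Φ) Θ' := by
  refine Lift.induction (C := fun Θ Θ' => Lift (fun s => Step s (some a)) (extDist Θ Φ) Θ') ?_ ?_ h
  · intro a b ha hb hab Δ₁ Δ₂ Θ₁ Θ₂ h₁ h₂
    simp only [extDist_pair_left]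
    exact Lift.biConvex _ a b ha hb hab _ _ _ _ h₁ h₂
  · rintro s Δ hs
    rw [extDist_single_left, ← iConvexComb_const Φ Δ]
    exact Lift.of_iConvexComb _ _ _ fun t _ => .ext_l hs

theorem lift_step_ext_right {a : Act} {Θ Θ' : FDist (SCSP Act)}
    (h : Lift (fun s => Step s (some a)) Θ Θ') (Φ : FDist (SCSP Act)) :
    Lift (fun s => Step s (some a)) (extDist Φ Θ) Θ' := by
  refine Lift.induction (C := fun Θ Θ' => Lift (fun s => Step s (some a)) (extDist Φ Θ) Θ') ?_ ?_ h
  · intro a b ha hb hab Δ₁ Δ₂ Θ₁ Θ₂ h₁ h₂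
    simp only [extDist_pair_right]
    exact Lift.biConvex _ a b ha hb hab _ _ _ _ h₁ h₂
  · rintro s Δ hs
    rw [extDist_single_right, ← iConvexComb_const Φ Δ]
    exact Lift.of_iConvexComb _ _ _ fun t _ => .ext_r hs

theorem Step.ext_cases {s t : SCSP Act} {α : Label Act} {Δ : FDist (SCSP Act)}
    (h : Step (.ext s t) α Δ) :
    (∃ a, α = some a ∧ (Step s (some a) Δ ∨ Step t (some a) Δ)) ∨
    (α = none ∧ ((∃ Δ', Step s none Δ' ∧ Δ = Δ'.map fun s' => .ext s' t) ∨
      ∃ Δ', Step t none Δ' ∧ Δ = Δ'.map fun t' => .ext s t')) := by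
  cases h with
  | ext_l h => exact Or.inl ⟨_, rfl, Or.inl h⟩
  | ext_r h => exact Or.inl ⟨_, rfl, Or.inr h⟩
  | ext_i_l h => exact Or.inr ⟨rfl, Or.inl ⟨_, h, rfl⟩⟩
  | ext_i_r h => exact Or.inr ⟨rfl, Or.inr ⟨_, h, rfl⟩⟩

theorem SCSP.refuses_ext {s t : SCSP Act} {X : Set Act} :
    (SCSP.ext s t).Refuses X ↔ s.Refuses X ∧ t.Refuses X := by
  constructor
  · intro h
    refine ⟨?_, ?_⟩
    · rintro α hα ⟨Δ, hs⟩
      cases α with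
      | none => exact h none hα ⟨_, .ext_i_l hs⟩
      | some a => exact h (some a) hα ⟨_, .ext_l hs⟩
    · rintro α hα ⟨Δ, hs⟩
      cases α with
      | none => exact h none hα ⟨_, .ext_i_r hs⟩
      | some a => exact h (some a) hα ⟨_, .ext_r hs⟩
  · rintro ⟨h, h'⟩ α hα ⟨Δ, hs⟩
    obtain ⟨a, rfl, hs | hs⟩ | ⟨rfl, ⟨Δ', hs', rfl⟩ | ⟨Δ', hs', rfl⟩⟩ := hs.ext_cases
    exacts [h _ hα ⟨_, hs⟩, h' _ hα ⟨_, hs⟩, h _ hα ⟨_, hs'⟩, h' _ hα ⟨_, hs'⟩]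

theorem RefusesDist.ext {X : Set Act} {Θ Φ : FDist (SCSP Act)} (h : RefusesDist Θ X)
    (h' : RefusesDist Φ X) : RefusesDist (extDist Θ Φ) X := by
  have hC : BiConvex fun (_ : FDist (SCSP Act)) (Δ : FDist (SCSP Act)) => RefusesDist Δ X :=
    fun a b ha hb hab _ _ _ _ h h' => h.convexCombPair h' a b ha hb hab
  rw [extDist_eq]
  refine hC.iConvexComb Θ (fun s => StdSimplex.single s) _ fun s hs => ?_
  refine hC.iConvexComb Φ (fun s => StdSimplex.single s) _ fun t ht => ?_
  exact refusesDist_single (SCSP.refuses_ext.2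
    ⟨h s (Finsupp.mem_support_iff.2 hs), h' t (Finsupp.mem_support_iff.2 ht)⟩)

/-- A visible step discards one component and lands in `GenBy b`. A τ step keeps the □ and stays in
the candidate relation. A refusal by s □ t is a refusal by both components, and the two sides of the
answer can reach theirs independently. -/
theorem GenBy.ext {s t : SCSP Act} {Θ Φ : FDist (SCSP Act)} (h : GenBy b s Θ) (h' : GenBy b t Φ) :
    GenBy b (.ext s t) (extDist Θ Φ) := by
  let R : SCSP Act → FDist (SCSP Act) → Prop := fun u Ψ =>
    ∃ s t Θ Φ, GenBy b s Θ ∧ GenBy b t Φ ∧ u = .ext s t ∧ Ψ = extDist Θ Φ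
  refine GenBy.coinduct R ?_ ?_ ⟨s, t, Θ, Φ, h, h', rfl, rfl⟩
  · rintro _ _ ⟨s, t, Θ, Φ, h, h', rfl, rfl⟩ α Δ hs
    obtain ⟨a, rfl, hs | hs⟩ | ⟨rfl, ⟨Δ', hs', rfl⟩ | ⟨Δ', hs', rfl⟩⟩ := hs.ext_cases
    · obtain ⟨Θ', ⟨Θ₁, Θ₂, h₁, h₂, h₃⟩, hl⟩ := h.step hs
      exact ⟨Θ', ⟨_, _, h₁.ext (WeakTau.refl Φ), lift_step_ext_left h₂ Φ, h₃⟩,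
        hl.mono fun _ _ => Or.inr⟩
    · obtain ⟨Θ', ⟨Θ₁, Θ₂, h₁, h₂, h₃⟩, hl⟩ := h'.step hs
      exact ⟨Θ', ⟨_, _, (WeakTau.refl Θ).ext h₁, lift_step_ext_right h₂ Θ, h₃⟩,
        hl.mono fun _ _ => Or.inr⟩
    · obtain ⟨Θ', hw, hl⟩ := h.step hs'
      refine ⟨extDist Θ' Φ, WeakTau.ext hw (WeakTau.refl Φ), ?_⟩
      rw [← extDist_single_right]
      refine Lift.mono (R := R) (fun _ _ => Or.inl) ?_
      refine Lift.induction (C := fun Δ Θ => Lift R (extDist Δ _) (extDist Θ Φ))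
        ((Lift.biConvex R).extDist_left _ _) (fun s Θ h => ?_) hl
      rw [extDist_single_right, StdSimplex.map_single]
      exact Lift.single ⟨s, t, Θ, Φ, h, h', rfl, rfl⟩
    · obtain ⟨Θ', hw, hl⟩ := h'.step hs'
      refine ⟨extDist Θ Θ', WeakTau.ext (WeakTau.refl Θ) hw, ?_⟩
      rw [← extDist_single_left]
      refine Lift.mono (R := R) (fun _ _ => Or.inl) ?_
      refine Lift.induction (C := fun Δ Φ => Lift R (extDist _ Δ) (extDist Θ Φ))
        ((Lift.biConvex R).extDist_right _ _) (fun t Φ h' => ?_) hl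
      rw [extDist_single_right, StdSimplex.map_single]
      exact Lift.single ⟨s, t, Θ, Φ, h, h', rfl, rfl⟩
  · rintro hb _ _ ⟨s, t, Θ, Φ, h, h', rfl, rfl⟩ X hX
    obtain ⟨hX, hX'⟩ := SCSP.refuses_ext.1 hX
    obtain ⟨Θ', h₁, h₂⟩ := h.refuses hb hX
    obtain ⟨Φ', h₁', h₂'⟩ := h'.refuses hb hX'
    exact ⟨_, h₁.ext h₁', h₂.ext h₂'⟩

theorem GenLE.ext {Δ Δ' Θ Θ' : FDist (SCSP Act)} (h : GenLE b Δ Θ) (h' : GenLE b Δ' Θ') :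
    GenLE b (extDist Δ Δ') (extDist Θ Θ') := by
  obtain ⟨Θ₁, h₁, h₂⟩ := h
  obtain ⟨Θ₂, h₃, h₄⟩ := h'
  refine ⟨_, h₁.ext h₃, ?_⟩
  refine Lift.induction (C := fun Δ Θ => Lift (GenBy b) (extDist Δ Δ') (extDist Θ Θ₂))
    ((Lift.biConvex _).extDist_left _ _) (fun s Θ h => ?_) h₂
  refine Lift.induction (C := fun Δ Φ => Lift (GenBy b) (extDist _ Δ) (extDist Θ Φ))
    ((Lift.biConvex _).extDist_right _ _) (fun t Φ h' => ?_) h₄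
  rw [extDist_single_right, StdSimplex.map_single]
  exact Lift.single (h.ext h')

end GenSim

/-! ## Soundness of the axioms -/

section Soundness

variable {Act : Type*} {b : Prop}

theorem BiConvex.diag {S : Type*} {C : FDist S → FDist S → Prop} (hC : BiConvex C)
    (h : ∀ s, C (StdSimplex.single s) (StdSimplex.single s)) (Δ : FDist S) : C Δ Δ := by
  have := hC.iConvexComb Δ _ _ fun s _ => h s
  rwa [iConvexComb_single_fun] at this

/-- States related by a strong bisimulation simulate each other. -/
theorem GenBy.of_bisim (r : SCSP Act → SCSP Act → Prop) (hsymm : ∀ s t, r s t → r t s)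
    (hstep : ∀ s t, r s t → ∀ α Δ, Step s α Δ → ∃ Δ', Step t α Δ' ∧
      Lift (fun s Φ => ∃ t, (r s t ∨ s = t) ∧ Φ = StdSimplex.single t) Δ Δ')
    {s t : SCSP Act} (h : r s t) : GenBy b s (StdSimplex.single t) := by
  refine GenBy.coinduct (fun s Φ => ∃ t, r s t ∧ Φ = StdSimplex.single t) ?_ ?_ ⟨t, h, rfl⟩
  · rintro s _ ⟨t, h, rfl⟩ α Δ hs
    obtain ⟨Δ', h₁, h₂⟩ := hstep s t h α Δ hs
    refine ⟨Δ', Weak.of_step h₁, h₂.mono ?_⟩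
    rintro s _ ⟨t, h | rfl, rfl⟩
    · exact Or.inl ⟨t, h, rfl⟩
    · exact Or.inr (GenBy.refl _)
  · rintro _ s _ ⟨t, h, rfl⟩ X hX
    refine ⟨_, WeakTau.refl _, refusesDist_single ?_⟩
    rintro α hα ⟨Δ, ht⟩
    obtain ⟨Δ', h₁, _⟩ := hstep t s (hsymm _ _ h) α Δ ht
    exact hX α hα ⟨_, h₁⟩

theorem lift_bisim_refl (r : SCSP Act → SCSP Act → Prop) (Δ : FDist (SCSP Act)) :
    Lift (fun s Φ => ∃ t, (r s t ∨ s = t) ∧ Φ = StdSimplex.single t) Δ Δ :=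
  Lift.refl _ fun s _ => ⟨s, Or.inr rfl, rfl⟩

theorem lift_bisim_map (r : SCSP Act → SCSP Act → Prop) (Δ : FDist (SCSP Act))
    (f g : SCSP Act → SCSP Act) (h : ∀ s, r (f s) (g s)) :
    Lift (fun s Φ => ∃ t, (r s t ∨ s = t) ∧ Φ = StdSimplex.single t) (Δ.map f) (Δ.map g) :=
  Lift.map_map _ _ _ fun s => ⟨g s, Or.inl (h s), rfl⟩

theorem genBy_ext_comm (s t : SCSP Act) :
    GenBy b (.ext s t) (StdSimplex.single (.ext t s)) := by
  refine GenBy.of_bisim (fun s t => ∃ u v, s = .ext u v ∧ t = .ext v u) ?_ ?_ ⟨s, t, rfl, rfl⟩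
  · rintro _ _ ⟨u, v, rfl, rfl⟩
    exact ⟨v, u, rfl, rfl⟩
  · rintro _ _ ⟨u, v, rfl, rfl⟩ α Δ h
    replace h := h.ext_cases
    obtain ⟨a, rfl, h | h⟩ | ⟨rfl, ⟨Δ, h, rfl⟩ | ⟨Δ, h, rfl⟩⟩ := h
    · exact ⟨_, .ext_r h, lift_bisim_refl _ _⟩
    · exact ⟨_, .ext_l h, lift_bisim_refl _ _⟩
    · exact ⟨_, .ext_i_r h, lift_bisim_map _ _ _ _ fun s => ⟨_, _, rfl, rfl⟩⟩
    · exact ⟨_, .ext_i_l h, lift_bisim_map _ _ _ _ fun s => ⟨_, _, rfl, rfl⟩⟩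

theorem genBy_ext_assoc (s t u : SCSP Act) :
    GenBy b (.ext (.ext s t) u) (StdSimplex.single (.ext s (.ext t u))) ∧
      GenBy b (.ext s (.ext t u)) (StdSimplex.single (.ext (.ext s t) u)) := by
  -- Both orientations are included because `GenBy.of_bisim` requires a symmetric relation.
  let r : SCSP Act → SCSP Act → Prop := fun x y => ∃ s t u,
    (x = .ext (.ext s t) u ∧ y = .ext s (.ext t u)) ∨
    (y = .ext (.ext s t) u ∧ x = .ext s (.ext t u))
  have hsymm : ∀ s t, r s t → r t s := by
    rintro _ _ ⟨s, t, u, h⟩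
    exact ⟨s, t, u, h.symm⟩
  have hstep : ∀ s t, r s t → ∀ α Δ, Step s α Δ → ∃ Δ', Step t α Δ' ∧
      Lift (fun s Φ => ∃ t, (r s t ∨ s = t) ∧ Φ = StdSimplex.single t) Δ Δ' := by
    rintro _ _ ⟨s, t, u, ⟨rfl, rfl⟩ | ⟨rfl, rfl⟩⟩ α Δ h
    · replace h := h.ext_cases
      obtain ⟨a, rfl, h | h⟩ | ⟨rfl, ⟨Δ, h, rfl⟩ | ⟨Δ, h, rfl⟩⟩ := h
      · replace h := h.ext_cases
        obtain ⟨_, _, h | h⟩ | ⟨h', _⟩ := h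
        · exact ⟨_, .ext_l (by simp_all), lift_bisim_refl _ _⟩
        · exact ⟨_, .ext_r (.ext_l (by simp_all)), lift_bisim_refl _ _⟩
        · cases h'
      · exact ⟨_, .ext_r (.ext_r h), lift_bisim_refl _ _⟩
      · replace h := h.ext_cases
        obtain ⟨_, h', _⟩ | ⟨-, ⟨Δ, h, rfl⟩ | ⟨Δ, h, rfl⟩⟩ := h
        · cases h'
        · refine ⟨_, .ext_i_l h, ?_⟩
          rw [StdSimplex.map_map]
          exact lift_bisim_map _ _ _ _ fun x => ⟨_, _, _, Or.inl ⟨rfl, rfl⟩⟩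
        · refine ⟨_, .ext_i_r (.ext_i_l h), ?_⟩
          rw [StdSimplex.map_map, StdSimplex.map_map]
          exact lift_bisim_map _ _ _ _ fun x => ⟨_, _, _, Or.inl ⟨rfl, rfl⟩⟩
      · refine ⟨_, .ext_i_r (.ext_i_r h), ?_⟩
        rw [StdSimplex.map_map]
        exact lift_bisim_map _ _ _ _ fun x => ⟨_, _, _, Or.inl ⟨rfl, rfl⟩⟩
    · replace h := h.ext_cases
      obtain ⟨a, rfl, h | h⟩ | ⟨rfl, ⟨Δ, h, rfl⟩ | ⟨Δ, h, rfl⟩⟩ := h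
      · exact ⟨_, .ext_l (.ext_l h), lift_bisim_refl _ _⟩
      · replace h := h.ext_cases
        obtain ⟨_, _, h | h⟩ | ⟨h', _⟩ := h
        · exact ⟨_, .ext_l (.ext_r (by simp_all)), lift_bisim_refl _ _⟩
        · exact ⟨_, .ext_r (by simp_all), lift_bisim_refl _ _⟩
        · cases h'
      · refine ⟨_, .ext_i_l (.ext_i_l h), ?_⟩
        rw [StdSimplex.map_map]
        exact lift_bisim_map _ _ _ _ fun x => ⟨_, _, _, Or.inr ⟨rfl, rfl⟩⟩
      · replace h := h.ext_cases
        obtain ⟨_, h', _⟩ | ⟨-, ⟨Δ, h, rfl⟩ | ⟨Δ, h, rfl⟩⟩ := h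
        · cases h'
        · refine ⟨_, .ext_i_l (.ext_i_r h), ?_⟩
          rw [StdSimplex.map_map, StdSimplex.map_map]
          exact lift_bisim_map _ _ _ _ fun x => ⟨_, _, _, Or.inr ⟨rfl, rfl⟩⟩
        · refine ⟨_, .ext_i_r h, ?_⟩
          rw [StdSimplex.map_map]
          exact lift_bisim_map _ _ _ _ fun x => ⟨_, _, _, Or.inr ⟨rfl, rfl⟩⟩
  exact ⟨GenBy.of_bisim r hsymm hstep ⟨s, t, u, Or.inl ⟨rfl, rfl⟩⟩,
    GenBy.of_bisim r hsymm hstep ⟨s, t, u, Or.inr ⟨rfl, rfl⟩⟩⟩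

theorem genBy_ext_nil (s : SCSP Act) :
    GenBy b (.ext s .nil) (StdSimplex.single s) ∧ GenBy b s (StdSimplex.single (.ext s .nil)) := by
  let r : SCSP Act → SCSP Act → Prop := fun x y => x = .ext y .nil ∨ y = .ext x .nil
  have hsymm : ∀ s t, r s t → r t s := fun _ _ => Or.symm
  have hstep : ∀ s t, r s t → ∀ α Δ, Step s α Δ → ∃ Δ', Step t α Δ' ∧
      Lift (fun s Φ => ∃ t, (r s t ∨ s = t) ∧ Φ = StdSimplex.single t) Δ Δ' := by
    rintro s t (rfl | rfl) α Δ h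
    · replace h := h.ext_cases
      obtain ⟨a, rfl, h | h⟩ | ⟨rfl, ⟨Δ, h, rfl⟩ | ⟨Δ, h, rfl⟩⟩ := h
      · exact ⟨_, h, lift_bisim_refl _ _⟩
      · exact (Step.not_nil h).elim
      · refine ⟨Δ, h, ?_⟩
        have := lift_bisim_map r Δ (fun s => .ext s .nil) id fun s => Or.inl rfl
        rwa [StdSimplex.map_id] at this
      · exact (Step.not_nil h).elim
    · cases α with
      | some a => exact ⟨_, .ext_l h, lift_bisim_refl _ _⟩
      | none =>
        refine ⟨_, .ext_i_l h, ?_⟩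
        have := lift_bisim_map r Δ id (fun s => .ext s .nil) fun s => Or.inr rfl
        rwa [StdSimplex.map_id] at this
  exact ⟨GenBy.of_bisim r hsymm hstep (Or.inl rfl), GenBy.of_bisim r hsymm hstep (Or.inr rfl)⟩

theorem GenLE.ext_comm (Δ Θ : FDist (SCSP Act)) : GenLE b (extDist Δ Θ) (extDist Θ Δ) := by
  refine BiConvex.diag (C := fun Δ Δ' => GenLE b (extDist Δ Θ) (extDist Θ Δ')) ?_ (fun s => ?_) Δ
  · intro a b ha hb hab Δ₁ Δ₂ Θ₁ Θ₂ h₁ h₂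
    simp only [extDist_pair_left, extDist_pair_right]
    exact GenLE.biConvex a b ha hb hab _ _ _ _ h₁ h₂
  refine BiConvex.diag (C := fun Θ Θ' => GenLE b (extDist _ Θ) (extDist Θ' _)) ?_ (fun t => ?_) Θ
  · intro a b ha hb hab Δ₁ Δ₂ Θ₁ Θ₂ h₁ h₂
    simp only [extDist_pair_left, extDist_pair_right]
    exact GenLE.biConvex a b ha hb hab _ _ _ _ h₁ h₂
  simpa [extDist_single_left] using GenLE.of_genBy (genBy_ext_comm s t)

theorem GenLE.ext_assoc (Δ Θ Φ : FDist (SCSP Act)) :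
    GenLE b (extDist (extDist Δ Θ) Φ) (extDist Δ (extDist Θ Φ)) ∧
      GenLE b (extDist Δ (extDist Θ Φ)) (extDist (extDist Δ Θ) Φ) := by
  refine BiConvex.diag (C := fun Δ Δ' =>
    GenLE b (extDist (extDist Δ Θ) Φ) (extDist Δ' (extDist Θ Φ)) ∧
      GenLE b (extDist Δ (extDist Θ Φ)) (extDist (extDist Δ' Θ) Φ)) ?_ (fun s => ?_) Δ
  · rintro a b ha hb hab Δ₁ Δ₂ Θ₁ Θ₂ ⟨h₁, h₁'⟩ ⟨h₂, h₂'⟩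
    simp only [extDist_pair_left]
    exact ⟨GenLE.biConvex a b ha hb hab _ _ _ _ h₁ h₂, GenLE.biConvex a b ha hb hab _ _ _ _ h₁' h₂'⟩
  refine BiConvex.diag (C := fun Θ Θ' =>
    GenLE b (extDist (extDist _ Θ) Φ) (extDist _ (extDist Θ' Φ)) ∧
      GenLE b (extDist _ (extDist Θ Φ)) (extDist (extDist _ Θ') Φ)) ?_ (fun t => ?_) Θ
  · rintro a b ha hb hab Δ₁ Δ₂ Θ₁ Θ₂ ⟨h₁, h₁'⟩ ⟨h₂, h₂'⟩
    simp only [extDist_pair_left, extDist_pair_right]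
    exact ⟨GenLE.biConvex a b ha hb hab _ _ _ _ h₁ h₂, GenLE.biConvex a b ha hb hab _ _ _ _ h₁' h₂'⟩
  refine BiConvex.diag (C := fun Φ Φ' =>
    GenLE b (extDist (extDist _ _) Φ) (extDist _ (extDist _ Φ')) ∧
      GenLE b (extDist _ (extDist _ Φ)) (extDist (extDist _ _) Φ')) ?_ (fun u => ?_) Φ
  · rintro a b ha hb hab Δ₁ Δ₂ Θ₁ Θ₂ ⟨h₁, h₁'⟩ ⟨h₂, h₂'⟩
    simp only [extDist_pair_right]
    exact ⟨GenLE.biConvex a b ha hb hab _ _ _ _ h₁ h₂, GenLE.biConvex a b ha hb hab _ _ _ _ h₁' h₂'⟩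
  simpa [extDist_single_left] using
    And.intro (GenLE.of_genBy (genBy_ext_assoc (b := b) s t u).1)
      (GenLE.of_genBy (genBy_ext_assoc s t u).2)

theorem GenLE.ext_nil (Δ : FDist (SCSP Act)) :
    GenLE b (extDist Δ (StdSimplex.single .nil)) Δ ∧
      GenLE b Δ (extDist Δ (StdSimplex.single .nil)) := by
  refine BiConvex.diag (C := fun Δ Δ' => GenLE b (extDist Δ (StdSimplex.single .nil)) Δ' ∧
      GenLE b Δ (extDist Δ' (StdSimplex.single .nil))) ?_ (fun s => ?_) Δ
  · rintro a b ha hb hab Δ₁ Δ₂ Θ₁ Θ₂ ⟨h₁, h₁'⟩ ⟨h₂, h₂'⟩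
    simp only [extDist_pair_left]
    exact ⟨GenLE.biConvex a b ha hb hab _ _ _ _ h₁ h₂, GenLE.biConvex a b ha hb hab _ _ _ _ h₁' h₂'⟩
  simpa [extDist_single_left] using
    And.intro (GenLE.of_genBy (genBy_ext_nil (b := b) s).1) (GenLE.of_genBy (genBy_ext_nil s).2)

/-- Offering a further action `c` is harmless for simulations but removes a refusal unless `c`
equals `a`. The conditional hypothesis lets the same lemma serve May0 and EI. -/
theorem GenLE.pre_le_ext (a c : Act) (P Q : PCSP Act) (h : b → a = c) :
    GenLE b (PCSP.pre a P).den ((PCSP.pre a P).ext (.pre c Q)).den := by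
  refine GenLE.pre_le (Weak.of_step (.ext_l (.action a P))) (lift_genBy_refl _) ?_
  intro hb X hX
  exact ⟨_, WeakTau.refl _, refusesDist_single
    (SCSP.refuses_ext.2 ⟨SCSP.refuses_pre.2 hX, SCSP.refuses_pre.2 (h hb ▸ hX)⟩)⟩

/-- Either visible action is reached by first resolving the internal choice in its favour. Whatever
both prefixes refuse is refused by the left one alone, so no assumption on the actions is needed. -/
theorem GenLE.ext_pre_le_int (a c : Act) (P Q : PCSP Act) :
    GenLE b ((PCSP.pre a P).ext (.pre c Q)).den ((PCSP.pre a P).int (.pre c Q)).den := by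
  refine GenLE.of_genBy (GenBy.unfold ?_ ?_)
  · intro α Δ hs
    obtain ⟨x, rfl, h | h⟩ | ⟨rfl, ⟨_, h, _⟩ | ⟨_, h, _⟩⟩ := hs.ext_cases
    · exact ⟨Δ, Weak.trans_left (WeakTau.of_step (.int_l _ _)) (Weak.of_step h),
        lift_genBy_refl _⟩
    · exact ⟨Δ, Weak.trans_left (WeakTau.of_step (.int_r _ _)) (Weak.of_step h),
        lift_genBy_refl _⟩
    · simpa using (Step.pre_iff.1 h).1
    · simpa using (Step.pre_iff.1 h).1
  · intro _ X hX
    exact ⟨_, WeakTau.of_step (.int_l _ _), refusesDist_single (SCSP.refuses_ext.1 hX).1⟩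

theorem GenLE.int_le_ext_pre (a c : Act) (P Q : PCSP Act) (h : b → a = c) :
    GenLE b ((PCSP.pre a P).int (.pre c Q)).den ((PCSP.pre a P).ext (.pre c Q)).den := by
  refine GenLE.int (GenLE.pre_le_ext a c P Q h) ?_
  refine (GenLE.pre_le_ext c a Q P fun hb => (h hb).symm).trans ?_
  rw [PCSP.den_ext, PCSP.den_ext]
  exact GenLE.ext_comm _ _

theorem GenLE.ext_pre_int (a : Act) (P Q R : PCSP Act) :
    GenLE b ((PCSP.pre a P).ext (.int Q R)).den
      (((PCSP.pre a P).ext Q).int ((PCSP.pre a P).ext R)).den := by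
  refine GenLE.of_genBy (GenBy.unfold ?_ ?_)
  · intro α Δ hs
    obtain ⟨x, rfl, h | h⟩ | ⟨rfl, ⟨_, h, _⟩ | ⟨Δ', h, rfl⟩⟩ := hs.ext_cases
    · refine ⟨Δ, Weak.trans_left (WeakTau.of_step (.int_l _ _))
        ⟨_, _, WeakTau.refl _, ?_, WeakTau.refl _⟩, lift_genBy_refl _⟩
      rw [PCSP.den_ext]
      exact lift_step_ext_left (Lift.single h) _
    · simpa using (Step.int_iff.1 h).1
    · simpa using (Step.pre_iff.1 h).1
    · rw [← extDist_single_left]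
      obtain ⟨_, rfl | rfl⟩ := Step.int_iff.1 h
      · refine ⟨_, WeakTau.of_step (.int_l _ _), ?_⟩
        rw [PCSP.den_ext]
        exact lift_genBy_refl _
      · refine ⟨_, WeakTau.of_step (.int_r _ _), ?_⟩
        rw [PCSP.den_ext]
        exact lift_genBy_refl _
  · intro _ X hX
    exact ((Step.int_l Q R).not_refuses (SCSP.refuses_ext.1 hX).2).elim

/-- The left-hand state has exactly four τ steps and no visible ones. Each of the four summands is
one of its derivatives. -/
theorem GenLE.ext_int_int (P₁ P₂ Q₁ Q₂ : PCSP Act) :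
    GenLE b ((PCSP.int P₁ P₂).ext (.int Q₁ Q₂)).den
      ((((P₁.ext (.int Q₁ Q₂)).int (P₂.ext (.int Q₁ Q₂))).int
        ((PCSP.int P₁ P₂).ext Q₁)).int ((PCSP.int P₁ P₂).ext Q₂)).den := by
  have hl (P Q : PCSP Act) : WeakTau (P.int Q).den P.den := WeakTau.of_step (.int_l P Q)
  have hr (P Q : PCSP Act) : WeakTau (P.int Q).den Q.den := WeakTau.of_step (.int_r P Q)
  refine GenLE.of_genBy (GenBy.unfold ?_ ?_)
  · intro α Δ hs
    obtain ⟨x, rfl, h | h⟩ | ⟨rfl, ⟨Δ', h, rfl⟩ | ⟨Δ', h, rfl⟩⟩ := hs.ext_cases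
    · simpa using (Step.int_iff.1 h).1
    · simpa using (Step.int_iff.1 h).1
    · rw [← extDist_single_right]
      obtain ⟨_, rfl | rfl⟩ := Step.int_iff.1 h
      · refine ⟨_, (hl _ _).trans ((hl _ _).trans (hl _ _)), ?_⟩
        rw [PCSP.den_ext]
        exact lift_genBy_refl _
      · refine ⟨_, (hl _ _).trans ((hl _ _).trans (hr _ _)), ?_⟩
        rw [PCSP.den_ext]
        exact lift_genBy_refl _
    · rw [← extDist_single_left]
      obtain ⟨_, rfl | rfl⟩ := Step.int_iff.1 h
      · refine ⟨_, (hl _ _).trans (hr _ _), ?_⟩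
        rw [PCSP.den_ext]
        exact lift_genBy_refl _
      · refine ⟨_, hr _ _, ?_⟩
        rw [PCSP.den_ext]
        exact lift_genBy_refl _
  · intro _ X hX
    exact ((Step.int_l Q₁ Q₂).not_refuses (SCSP.refuses_ext.1 hX).2).elim

theorem GenLE.ext_mono {P P' Q Q' : PCSP Act} (h : GenLE b P.den P'.den)
    (h' : GenLE b Q.den Q'.den) : GenLE b (P.ext Q).den (P'.ext Q').den := by
  rw [PCSP.den_ext, PCSP.den_ext]
  exact h.ext h'

theorem PCSP.den_prob_compl (p : Prb) (P Q : PCSP Act) :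
    (PCSP.prob p P Q).den = (PCSP.prob p.compl Q P).den := by
  ext s
  simp [PCSP.den, Prb.compl, add_comm]

theorem PCSP.den_prob_assoc (p q : Prb) (P Q R : PCSP Act) :
    (PCSP.prob q (.prob p P Q) R).den =
      (PCSP.prob (p.mul q) P (.prob (p.assoc q) Q R)).den := by
  have h : (1 : ℝ) - p * q ≠ 0 := (sub_pos.2 (p.mul q).2.2).ne'
  ext s
  simp only [PCSP.den, Prb.mul, Prb.assoc, StdSimplex.weights_convexCombPair, Finsupp.add_apply,
    Finsupp.smul_apply, smul_eq_mul]
  generalize (p : ℝ) = x at *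
  generalize (q : ℝ) = y at *
  have h' : (1 : ℝ) - y * x ≠ 0 := by rwa [mul_comm]
  field_simp
  ring

theorem CommonEq.sound {P Q : PCSP Act} (h : CommonEq P Q) :
    GenLE b P.den Q.den ∧ GenLE b Q.den P.den := by
  have of_eq {P Q : PCSP Act} (h : P.den = Q.den) : GenLE b P.den Q.den ∧ GenLE b Q.den P.den :=
    h ▸ ⟨GenLE.refl _, GenLE.refl _⟩
  have L (P Q : PCSP Act) : GenLE b P.den (P.int Q).den := GenLE.int_left P Q
  have R (P Q : PCSP Act) : GenLE b Q.den (P.int Q).den := GenLE.int_right P Q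
  cases h with
  | p1 p P => exact of_eq (by simp [PCSP.den])
  | p2 p P Q => exact of_eq (PCSP.den_prob_compl p P Q)
  | p3 p q P Q S => exact of_eq (PCSP.den_prob_assoc p q P Q S)
  | i1 P => exact ⟨GenLE.int (GenLE.refl _) (GenLE.refl _), L _ _⟩
  | i2 P Q => exact ⟨GenLE.int (R _ _) (L _ _), GenLE.int (R _ _) (L _ _)⟩
  | i3 P Q S =>
    exact ⟨GenLE.int (GenLE.int (L _ _) ((L _ _).trans (R _ _))) ((R _ _).trans (R _ _)),
      GenLE.int ((L _ _).trans (L _ _)) (GenLE.int ((R _ _).trans (L _ _)) (R _ _))⟩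
  | e1 P => rw [PCSP.den_ext]; exact GenLE.ext_nil _
  | e2 P Q => rw [PCSP.den_ext, PCSP.den_ext]; exact ⟨GenLE.ext_comm _ _, GenLE.ext_comm _ _⟩
  | e3 P Q S => simp only [PCSP.den_ext]; exact GenLE.ext_assoc _ _ _
  | ei a P Q => exact ⟨GenLE.ext_pre_le_int a a P Q, GenLE.int_le_ext_pre a a P Q fun _ => rfl⟩
  -- The two sides are the same term, since `PCSP.ext` recurses on its right argument.
  | d1 p P Q S => exact ⟨GenLE.refl _, GenLE.refl _⟩
  | d2 a P Q S =>
    exact ⟨GenLE.ext_pre_int a P Q S,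
      GenLE.int (GenLE.ext_mono (GenLE.refl _) (L _ _)) (GenLE.ext_mono (GenLE.refl _) (R _ _))⟩
  | d3 P₁ P₂ Q₁ Q₂ =>
    exact ⟨GenLE.ext_int_int P₁ P₂ Q₁ Q₂,
      GenLE.int (GenLE.int (GenLE.int (GenLE.ext_mono (L _ _) (GenLE.refl _))
        (GenLE.ext_mono (R _ _) (GenLE.refl _))) (GenLE.ext_mono (GenLE.refl _) (L _ _)))
        (GenLE.ext_mono (GenLE.refl _) (R _ _))⟩

theorem MayAxiom.sound {P Q : PCSP Act} (h : MayAxiom P Q) : GenLE False P.den Q.den := by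
  cases h with
  | eq h => exact h.sound.1
  | eq_symm h => exact h.sound.2
  | may0 a c P Q => exact GenLE.ext_pre_le_int a c P Q
  | may0_symm a c P Q => exact GenLE.int_le_ext_pre a c P Q False.elim
  | may1 P Q => exact GenLE.int_left P Q
  | may2 P =>
    exact GenLE.of_genBy (GenBy.unfold (fun _ _ h => (Step.not_nil h).elim) False.elim)
  | may3 a p P Q =>
    refine GenLE.pre_le ⟨_, _, WeakTau.refl _, ?_, WeakTau.refl _⟩ (lift_genBy_refl _) False.elim
    -- Both halves of the mixture perform `a` simultaneously and arrive at the mixture of `P` and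
    -- `Q`.
    exact Lift.biConvex _ _ _ _ _ _ _ _ _ _ (Lift.single (.action a P)) (Lift.single (.action a Q))

theorem bigProb_biConvex {C : FDist (SCSP Act) → FDist (SCSP Act) → Prop} (hC : BiConvex C) :
    ∀ (n : ℕ) (w : Fin (n + 1) → ℝ) (hw : ∀ i, 0 < w i) (P Q : Fin (n + 1) → PCSP Act),
      (∀ i, C (P i).den (Q i).den) → C (PCSP.bigProb n w hw P).den (PCSP.bigProb n w hw Q).den
  | 0, _, _, _, _, h => h 0
  | n + 1, _, _, _, _, h =>
    hC _ _ _ _ _ _ _ _ _ (h 0) (bigProb_biConvex hC n _ _ _ _ fun i => h i.succ)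

theorem weakTau_bigInt : ∀ (n : ℕ) (P : Fin (n + 1) → PCSP Act) (i : Fin (n + 1)),
    WeakTau (PCSP.bigInt n P).den (P i).den
  | 0, P, i => by rw [Fin.fin_one_eq_zero i]; exact WeakTau.refl _
  | n + 1, P, i => by
    refine Fin.cases ?_ (fun i => ?_) i
    · exact WeakTau.of_step (.int_l _ _)
    · exact WeakTau.trans (WeakTau.of_step (.int_r _ _)) (weakTau_bigInt n (fun i => P i.succ) i)

theorem weakTau_intFamily_left (R : PCSP Act) : ∀ (n : ℕ) (P : Fin n → PCSP Act),
    WeakTau (PCSP.intFamily R n P).den R.den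
  | 0, _ => WeakTau.refl _
  | _ + 1, _ => WeakTau.of_step (.int_l _ _)

theorem weakTau_intFamily_right (R : PCSP Act) : ∀ (n : ℕ) (P : Fin n → PCSP Act) (i : Fin n),
    WeakTau (PCSP.intFamily R n P).den (P i).den
  | _ + 1, _, i => WeakTau.trans (WeakTau.of_step (.int_r _ _)) (weakTau_bigInt _ _ i)

theorem bigExt_pre : ∀ (n : ℕ) (a : Fin n → Act) (T : Fin n → PCSP Act),
    ∃ s : SCSP Act, (PCSP.bigExt n fun i => PCSP.pre (a i) (T i)) = .state s ∧
      ∀ α Δ, Step s α Δ ↔ ∃ i, α = some (a i) ∧ Δ = (T i).den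
  | 0, _, _ => ⟨_, rfl, fun _ _ => ⟨fun h => (Step.not_nil h).elim, fun ⟨i, _⟩ => i.elim0⟩⟩
  | 1, a, T => ⟨_, rfl, fun α Δ => by rw [Step.pre_iff]; simp⟩
  | n + 2, a, T => by
    obtain ⟨s, hs, h⟩ := bigExt_pre (n + 1) (fun i => a i.succ) (fun i => T i.succ)
    refine ⟨.ext (.pre (a 0) (T 0)) s, by simp only [PCSP.bigExt, hs]; rfl, fun α Δ => ?_⟩
    rw [Fin.exists_fin_succ]
    constructor
    · intro hst
      obtain ⟨x, rfl, h' | h'⟩ | ⟨rfl, ⟨_, h', _⟩ | ⟨_, h', _⟩⟩ := hst.ext_cases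
      · exact Or.inl (Step.pre_iff.1 h')
      · exact Or.inr ((h _ _).1 h')
      · simpa using (Step.pre_iff.1 h').1
      · obtain ⟨i, hi, _⟩ := (h _ _).1 h'
        simp at hi
    · rintro (⟨rfl, rfl⟩ | ⟨i, rfl, rfl⟩)
      · exact .ext_l (.action _ _)
      · exact .ext_r ((h _ _).2 ⟨i, rfl, rfl⟩)

theorem Step.mem_inits {s : SCSP Act} {α : Label Act} {Δ : FDist (SCSP Act)} (h : Step s α Δ) :
    α ∈ s.inits := by
  induction h with
  | action | int_l | int_r => simp [SCSP.inits]
  | ext_l _ ih => exact Or.inl ih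
  | ext_r _ ih => exact Or.inr ih
  | ext_i_l _ ih => exact Or.inl ih
  | ext_i_r _ ih => exact Or.inr ih
  | par_l hA _ ih => exact Or.inl ⟨Or.inl ih, hA⟩
  | par_r hA _ ih => exact Or.inl ⟨Or.inr ih, hA⟩
  | par_i hA _ _ ih ih' => exact Or.inr ⟨rfl, _, hA, ih, ih'⟩

theorem inits_subset_of_den {P : PCSP Act} {s : SCSP Act} (h : P.den.weights s ≠ 0) :
    s.inits ⊆ P.inits := by
  match P with
  | .state t =>
    obtain rfl : s = t := by simpa [PCSP.den] using Finsupp.mem_support_iff.2 h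
    rw [PCSP.inits]
  | .prob p P Q =>
    rw [PCSP.den] at h
    rw [PCSP.inits]
    rcases weights_convexCombPair_ne_zero h with h | h
    · exact (inits_subset_of_den h).trans Set.subset_union_left
    · exact (inits_subset_of_den h).trans Set.subset_union_right

theorem MustAxiom.sound {P Q : PCSP Act} (h : MustAxiom P Q) : GenLE True Q.den P.den := by
  cases h with
  | eq h => exact h.sound.2
  | eq_symm h => exact h.sound.1
  | must1 P Q => exact GenLE.int_right P Q
  | must2 R n a m p p_pos p_sum Q P hR =>
    obtain ⟨s, hs, hstep⟩ := bigExt_pre n a fun i => PCSP.bigProb (m i) (p i) (p_pos i) (Q i)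
    rw [hs]
    refine GenLE.of_genBy (GenBy.unfold ?_ ?_)
    · intro α Δ h
      obtain ⟨i, rfl, rfl⟩ := (hstep _ _).1 h
      -- The i-th action is answered by resolving the internal choice to the i-th probabilistic sum.
      -- All states of that sum can perform it, with the `Q i j` as residuals.
      refine ⟨_, ⟨_, _, weakTau_intFamily_right _ _ _ i, ?_, WeakTau.refl _⟩, lift_genBy_refl _⟩
      refine bigProb_biConvex (Lift.biConvex _) _ _ _ _ _ fun j => ?_
      rw [PCSP.den_ext]
      exact lift_step_ext_left (Lift.single (.action _ _)) _
    · intro _ X hX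
      -- Refusals are answered by moving to `R`. Its initial actions lie among the `a i`, so it
      -- cannot perform τ or any action that the right-hand side refuses.
      refine ⟨_, weakTau_intFamily_left _ _ _, fun t ht α hα ⟨Δ, hΔ⟩ => ?_⟩
      obtain ⟨i, rfl⟩ := hR (inits_subset_of_den (Finsupp.mem_support_iff.1 ht) hΔ.mem_inits)
      exact hX _ hα ⟨_, (hstep _ _).2 ⟨i, rfl, rfl⟩⟩

/-- The disjunction covers the two orientations: `GenLE` itself for the may theory, and its opposite
for the must theory. -/
theorem Derivable.sound {Ax : PCSP Act → PCSP Act → Prop} {r : PCSP Act → PCSP Act → Prop}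
    {b : Prop} (hr : (∀ P Q, r P Q ↔ GenLE b P.den Q.den) ∨ ∀ P Q, r P Q ↔ GenLE b Q.den P.den)
    (hax : ∀ P Q, Ax P Q → r P Q) {P Q : PCSP Act} (h : Derivable Ax P Q) : r P Q := by
  have hint {P P' Q Q' : PCSP Act} (h : GenLE b P.den P'.den) (h' : GenLE b Q.den Q'.den) :
      GenLE b (P.int Q).den (P'.int Q').den :=
    GenLE.int (h.trans (GenLE.int_left _ _)) (h'.trans (GenLE.int_right _ _))
  rcases hr with hr | hr
  all_goals
    induction h with
    | ax _ _ h => exact hax _ _ h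
    | refl => exact (hr _ _).2 (GenLE.refl _)
    | trans _ _ ih ih' => rw [hr] at *; first | exact ih.trans ih' | exact ih'.trans ih
    | pre a _ ih => rw [hr] at *; exact ih.pre a
    | int _ _ ih ih' => rw [hr] at *; exact hint ih ih'
    | ext _ _ ih ih' => rw [hr] at *; exact ih.ext_mono ih'
    | prob p _ _ ih ih' => rw [hr] at *; exact GenLE.biConvex _ _ _ _ _ _ _ _ _ ih ih'

theorem simLE_of_mayDerivable {P Q : PCSP Act} (h : MayDerivable P Q) : SimLE P Q := by
  have : GenLE False P.den Q.den := Derivable.sound (r := fun P Q => GenLE False P.den Q.den)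
    (Or.inl fun _ _ => Iff.rfl) (fun _ _ => MayAxiom.sound) h
  rwa [GenLE, genBy_false] at this

theorem failSimLE_of_mustDerivable {P Q : PCSP Act} (h : MustDerivable P Q) : FailSimLE P Q := by
  have : GenLE True Q.den P.den := Derivable.sound (r := fun P Q => GenLE True Q.den P.den)
    (Or.inr fun _ _ => Iff.rfl) (fun _ _ => MustAxiom.sound) h
  rwa [GenLE, genBy_true] at this

end Soundness

/-! ## Barycentric algebras and their cones -/

/-- Algebras for the laws of binary probabilistic choice. -/
class Barycentric (N : Type*) where
  /-- Probabilistic choice. -/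
  mix : Prb → N → N → N
  mix_self : ∀ p x, mix p x x = x
  mix_compl : ∀ p x y, mix p x y = mix p.compl y x
  mix_assoc : ∀ p q x y z, mix q (mix p x y) z = mix (p.mul q) x (mix (p.assoc q) y z)

/-- The cone over a barycentric algebra: a point `0`, and the positive multiples of the elements. -/
inductive Cone (N : Type*) : Type _
  | zero : Cone N
  | mul (w : ℝ) (h : 0 < w) (x : N) : Cone N

namespace Cone

/-- The probability `w / (w + v)`. -/
noncomputable def ratio {w v : ℝ} (hw : 0 < w) (hv : 0 < v) : Prb :=
  ⟨w / (w + v), div_pos hw (add_pos hw hv),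
    (div_lt_one (add_pos hw hv)).2 (lt_add_of_pos_right _ hv)⟩

/-- The multiple `w • x`, which is `0` unless `w` is positive. -/
noncomputable def smul {N : Type*} (w : ℝ) (x : N) : Cone N :=
  open Classical in if h : 0 < w then mul w h x else zero

theorem smul_of_pos {N : Type*} {w : ℝ} (h : 0 < w) (x : N) : smul w x = mul w h x := dif_pos h

theorem mul_congr {N : Type*} {w v : ℝ} {hw : 0 < w} (h : w = v) {x y : N} (hxy : x = y) :
    mul w hw x = mul v (h ▸ hw) y := by
  subst h hxy
  rfl

theorem smul_injective {N : Type*} {w : ℝ} (hw : 0 < w) {x y : N} (h : smul w x = smul w y) :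
    x = y := by
  rw [smul_of_pos hw, smul_of_pos hw] at h
  injection h

instance {N : Type*} : Zero (Cone N) := ⟨zero⟩

theorem smul_zero {N : Type*} (x : N) : smul 0 x = 0 := dif_neg (lt_irrefl _)

variable {N : Type*} [Barycentric N]

noncomputable instance : Add (Cone N) where
  add
    | zero, y => y
    | x, zero => x
    | mul w hw x, mul v hv y => mul (w + v) (add_pos hw hv) (Barycentric.mix (ratio hw hv) x y)

theorem mul_add_mul {w v : ℝ} (hw : 0 < w) (hv : 0 < v) (x y : N) :
    mul w hw x + mul v hv y = mul (w + v) (add_pos hw hv) (Barycentric.mix (ratio hw hv) x y) :=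
  rfl

protected theorem zero_add (x : Cone N) : 0 + x = x := rfl

protected theorem add_zero (x : Cone N) : x + 0 = x := by cases x <;> rfl

/-- The weights carried by the cone absorb the renormalization: P2 becomes plain commutativity and
P3 plain associativity. -/
noncomputable instance : AddCommMonoid (Cone N) where
  zero_add := Cone.zero_add
  add_zero := Cone.add_zero
  add_comm x y := by
    match x, y with
    | zero, y => exact (Cone.add_zero y).symm
    | x, zero => exact Cone.add_zero x
    | mul w hw x, mul v hv y =>
      rw [mul_add_mul, mul_add_mul, Barycentric.mix_compl]
      have h : (ratio hw hv).compl = ratio hv hw := by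
        ext
        simp only [ratio, Prb.compl]
        rw [add_comm v]
        field_simp
        ring
      rw [h]
      exact mul_congr (add_comm _ _) rfl
  add_assoc x y z := by
    match x, y, z with
    | zero, y, z => rfl
    | mul _ _ _, zero, z => rfl
    | mul _ _ _, mul _ _ _, zero => rfl
    | mul w hw x, mul v hv y, mul u hu z =>
      simp only [mul_add_mul, Barycentric.mix_assoc]
      have h₁ : (ratio hw hv).mul (ratio (add_pos hw hv) hu) = ratio hw (add_pos hv hu) := by
        ext
        simp only [ratio, Prb.mul, ← add_assoc]
        field_simp
      have h₂ : (ratio hw hv).assoc (ratio (add_pos hw hv) hu) = ratio hv hu := by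
        ext
        have h : (1 : ℝ) - w / (w + v) * ((w + v) / (w + v + u)) = (v + u) / (w + v + u) := by
          field_simp
          ring
        simp only [ratio, Prb.assoc, h]
        field_simp
        ring
      rw [h₁, h₂]
      exact mul_congr (add_assoc _ _ _) rfl
  nsmul := nsmulRec

theorem smul_add {w v : ℝ} (hw : 0 ≤ w) (hv : 0 ≤ v) (x : N) :
    smul (w + v) x = smul w x + smul v x := by
  rcases hw.eq_or_lt with rfl | hw
  · rw [smul_zero, zero_add, zero_add]
  rcases hv.eq_or_lt with rfl | hv
  · rw [smul_zero, add_zero, add_zero]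
  rw [smul_of_pos hw, smul_of_pos hv, smul_of_pos (add_pos hw hv), mul_add_mul,
    Barycentric.mix_self]

theorem smul_mix {w : ℝ} (hw : 0 < w) (p : Prb) (x y : N) :
    smul w (Barycentric.mix p x y) = smul (w * p) x + smul (w * (1 - p)) y := by
  have hp : (0 : ℝ) < w * p := _root_.mul_pos hw p.2.1
  have hp' : (0 : ℝ) < w * (1 - p) := _root_.mul_pos hw (sub_pos.2 p.2.2)
  have h₁ : w * p + w * (1 - p) = w := by ring
  rw [smul_of_pos hw, smul_of_pos hp, smul_of_pos hp', mul_add_mul]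
  refine mul_congr h₁.symm ?_
  have h₂ : ratio hp hp' = p := by
    ext
    simp only [ratio, h₁]
    field_simp
  rw [h₂]

end Cone

namespace PCSP

variable {Act : Type*} {N : Type*} [Barycentric N]

/-- Evaluation of the probabilistic choices at the top of a term in a barycentric algebra. -/
def eval (f : SCSP Act → N) : PCSP Act → N
  | .state s => f s
  | .prob p P Q => Barycentric.mix p (P.eval f) (Q.eval f)

/-- Inside the cone, nested choices flatten to a sum over states with coefficients read off the
denotation. Allowing a general scale `w` and any finite set `T` containing the support makes the
induction go through both branches with a common index set. -/
theorem smul_eval (f : SCSP Act → N) (P : PCSP Act) (T : Finset (SCSP Act))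
    (hT : P.den.weights.support ⊆ T) {w : ℝ} (hw : 0 < w) :
    Cone.smul w (P.eval f) = ∑ s ∈ T, Cone.smul (w * P.den.weights s) (f s) := by
  classical
  match P with
  | .state t =>
    have ht : t ∈ T := hT (by simp [den])
    rw [Finset.sum_eq_single_of_mem t ht]
    · simp [eval, den]
    · intro s _ hs
      simp [den, Ne.symm hs, Cone.smul_zero]
  | .prob p P Q =>
    have hp : (0 : ℝ) < p := p.2.1
    have hp' : (0 : ℝ) < 1 - p := sub_pos.2 p.2.2
    have hmem (s) : (prob p P Q).den.weights s =
        p * P.den.weights s + (1 - p) * Q.den.weights s := by simp [den]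
    have hP : P.den.weights.support ⊆ T := fun s hs => hT <| by
      rw [Finsupp.mem_support_iff] at hs ⊢
      rw [hmem]
      have := lt_of_le_of_ne (P.den.weights_nonneg s) hs.symm
      have := Q.den.weights_nonneg s
      positivity
    have hQ : Q.den.weights.support ⊆ T := fun s hs => hT <| by
      rw [Finsupp.mem_support_iff] at hs ⊢
      rw [hmem]
      have := lt_of_le_of_ne (Q.den.weights_nonneg s) hs.symm
      have := P.den.weights_nonneg s
      positivity
    rw [eval, Cone.smul_mix hw, smul_eval f P T hP (mul_pos hw hp),
      smul_eval f Q T hQ (mul_pos hw hp'), ← Finset.sum_add_distrib]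
    refine Finset.sum_congr rfl fun s _ => ?_
    have := P.den.weights_nonneg s
    have := Q.den.weights_nonneg s
    rw [hmem, ← Cone.smul_add (by positivity) (by positivity)]
    congr 1
    ring

/-- The value of a term in a barycentric algebra only depends on its denotation. -/
theorem eval_eq_of_den_eq (f : SCSP Act → N) {P Q : PCSP Act} (h : P.den = Q.den) :
    P.eval f = Q.eval f := by
  refine Cone.smul_injective one_pos ?_
  rw [smul_eval f P _ subset_rfl one_pos, smul_eval f Q P.den.weights.support (by rw [h]) one_pos,
    h]

end PCSP

/-! ## Terms without parallel composition -/

section ParFree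

variable {Act : Type*}

namespace PCSP

@[simp] theorem parFree_state {s : SCSP Act} : (PCSP.state s).ParFree ↔ s.ParFree := by
  rw [PCSP.ParFree]

@[simp] theorem parFree_prob {p : Prb} {P Q : PCSP Act} :
    (PCSP.prob p P Q).ParFree ↔ P.ParFree ∧ Q.ParFree := by rw [PCSP.ParFree]

@[simp] theorem parFree_nil : (PCSP.nil : PCSP Act).ParFree := by simp [PCSP.nil, SCSP.ParFree]

@[simp] theorem parFree_pre {a : Act} {P : PCSP Act} : (PCSP.pre a P).ParFree ↔ P.ParFree := by
  simp [PCSP.pre, SCSP.ParFree]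

@[simp] theorem parFree_int {P Q : PCSP Act} : (PCSP.int P Q).ParFree ↔ P.ParFree ∧ Q.ParFree := by
  simp [PCSP.int, SCSP.ParFree]

theorem parFree_extState {P : PCSP Act} {t : SCSP Act} :
    (P.extState t).ParFree ↔ P.ParFree ∧ t.ParFree := by
  match P with
  | .state s => simp [PCSP.extState, SCSP.ParFree]
  | .prob p P Q =>
    simp only [PCSP.extState, parFree_prob, parFree_extState (P := P), parFree_extState (P := Q)]
    tauto

@[simp] theorem parFree_ext {P Q : PCSP Act} : (P.ext Q).ParFree ↔ P.ParFree ∧ Q.ParFree := by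
  match Q with
  | .state t => simp [PCSP.ext, parFree_extState]
  | .prob p Q R =>
    simp only [PCSP.ext, parFree_prob, parFree_ext (Q := Q), parFree_ext (Q := R)]
    tauto

end PCSP

/-- All states in the support are without parallel composition. -/
def ParFreeDist (Δ : FDist (SCSP Act)) : Prop := ∀ s, Δ.weights s ≠ 0 → s.ParFree

theorem weights_pair_ne_zero (p : Prb) {Δ Θ : FDist (SCSP Act)} {s : SCSP Act} {h₁ h₂ h₃} :
    (convexCombPair (p : ℝ) (1 - p) h₁ h₂ h₃ Δ Θ).weights s ≠ 0 ↔
      Δ.weights s ≠ 0 ∨ Θ.weights s ≠ 0 := by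
  refine ⟨weights_convexCombPair_ne_zero, fun h => ?_⟩
  have hp : (0 : ℝ) < p := p.2.1
  have hp' : (0 : ℝ) < 1 - p := sub_pos.2 p.2.2
  have h₁ := Δ.weights_nonneg s
  have h₂ := Θ.weights_nonneg s
  simp only [StdSimplex.weights_convexCombPair, Finsupp.add_apply, Finsupp.smul_apply, smul_eq_mul]
  rcases h with h | h
  · have := lt_of_le_of_ne h₁ h.symm
    positivity
  · have := lt_of_le_of_ne h₂ h.symm
    positivity

theorem parFreeDist_pair (p : Prb) {Δ Θ : FDist (SCSP Act)} {h₁ h₂ h₃} :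
    ParFreeDist (convexCombPair (p : ℝ) (1 - p) h₁ h₂ h₃ Δ Θ) ↔
      ParFreeDist Δ ∧ ParFreeDist Θ := by
  simp only [ParFreeDist, weights_pair_ne_zero]
  exact ⟨fun h => ⟨fun s hs => h s (Or.inl hs), fun s hs => h s (Or.inr hs)⟩,
    fun h s => Or.rec (h.1 s) (h.2 s)⟩

@[simp] theorem parFreeDist_single {s : SCSP Act} :
    ParFreeDist (StdSimplex.single s) ↔ s.ParFree := by
  refine ⟨fun h => h s (by simp), fun h t ht => ?_⟩
  obtain rfl : t = s := by simpa using Finsupp.mem_support_iff.2 ht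
  exact h

theorem parFreeDist_den {P : PCSP Act} : ParFreeDist P.den ↔ P.ParFree := by
  match P with
  | .state s => rw [PCSP.den, parFreeDist_single, PCSP.parFree_state]
  | .prob p P Q => rw [PCSP.den, parFreeDist_pair, parFreeDist_den, parFreeDist_den,
      PCSP.parFree_prob]

/-- Syntactic choice only has probabilities strictly between 0 and 1. For the degenerate weights the
mixture is one of its components. -/
theorem BiConvex.of_prob {S T : Type*} {C : FDist S → FDist T → Prop}
    (h : ∀ (p : Prb) (h₁ : (0 : ℝ) ≤ p) (h₂ : (0 : ℝ) ≤ 1 - p) (h₃ : (p : ℝ) + (1 - p) = 1)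
      (Δ₁ Δ₂ : FDist S) (Θ₁ Θ₂ : FDist T), C Δ₁ Θ₁ → C Δ₂ Θ₂ →
        C (convexCombPair (p : ℝ) (1 - p) h₁ h₂ h₃ Δ₁ Δ₂)
          (convexCombPair (p : ℝ) (1 - p) h₁ h₂ h₃ Θ₁ Θ₂)) : BiConvex C := by
  intro a b ha hb hab Δ₁ Δ₂ Θ₁ Θ₂ h₁ h₂
  obtain rfl : b = 1 - a := by linarith
  rcases ha.eq_or_lt with rfl | ha'
  · simpa using h₂
  rcases hb.eq_or_lt with hb' | hb'
  · obtain rfl : a = 1 := by linarith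
    simpa using h₁
  exact h ⟨a, ha', by linarith⟩ ha hb hab _ _ _ _ h₁ h₂

theorem exists_den_eq {Δ : FDist (SCSP Act)} (h : ParFreeDist Δ) :
    ∃ P : PCSP Act, P.ParFree ∧ P.den = Δ := by
  have hC : BiConvex fun (_ : FDist (SCSP Act)) Δ => ∃ P : PCSP Act, P.ParFree ∧ P.den = Δ := by
    refine BiConvex.of_prob ?_
    rintro p h₁ h₂ h₃ _ _ _ _ ⟨P, hP, rfl⟩ ⟨Q, hQ, rfl⟩
    exact ⟨.prob p P Q, by simp [*], rfl⟩
  have := hC.iConvexComb Δ (fun s => StdSimplex.single s) (fun s => StdSimplex.single s)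
    fun s hs => ⟨.state s, by simpa using h s hs, rfl⟩
  rwa [iConvexComb_single_fun] at this

/-! ### Transitions decrease the size -/

mutual

/-- A size of process terms that decreases along transitions. -/
def PCSP.height : PCSP Act → ℕ
  | .state s => s.height
  | .prob _ P Q => max P.height Q.height

/-- A size of state-based process terms that decreases along transitions. -/
def SCSP.height : SCSP Act → ℕ
  | .nil => 0
  | .pre _ P => P.height + 1
  | .int P Q => max P.height Q.height + 1
  -- A τ step of one component keeps the other, so a maximum would not decrease.
  | .ext s t => s.height + t.height + 1
  | .par _ _ _ => 0

end

theorem height_le_of_den {P : PCSP Act} {s : SCSP Act} (h : P.den.weights s ≠ 0) :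
    s.height ≤ P.height := by
  match P with
  | .state t =>
    obtain rfl : s = t := by simpa [PCSP.den] using Finsupp.mem_support_iff.2 h
    rw [PCSP.height]
  | .prob p P Q =>
    rw [PCSP.den] at h
    rw [PCSP.height]
    rcases weights_convexCombPair_ne_zero h with h | h
    · exact (height_le_of_den h).trans (le_max_left _ _)
    · exact (height_le_of_den h).trans (le_max_right _ _)

theorem Step.parFree_height {s : SCSP Act} {α : Label Act} {Δ : FDist (SCSP Act)}
    (h : Step s α Δ) (hs : s.ParFree) :
    ∀ t, Δ.weights t ≠ 0 → t.ParFree ∧ t.height < s.height := by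
  induction h with
  | action a P =>
    intro t ht
    rw [SCSP.ParFree] at hs
    rw [SCSP.height]
    exact ⟨parFreeDist_den.2 hs t ht, Nat.lt_succ_of_le (height_le_of_den ht)⟩
  | int_l P Q =>
    intro t ht
    rw [SCSP.ParFree] at hs
    rw [SCSP.height]
    exact ⟨parFreeDist_den.2 hs.1 t ht,
      Nat.lt_succ_of_le ((height_le_of_den ht).trans (le_max_left _ _))⟩
  | int_r P Q =>
    intro t ht
    rw [SCSP.ParFree] at hs
    rw [SCSP.height]
    exact ⟨parFreeDist_den.2 hs.2 t ht,
      Nat.lt_succ_of_le ((height_le_of_den ht).trans (le_max_right _ _))⟩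
  | ext_l _ ih =>
    intro t ht
    rw [SCSP.ParFree] at hs
    rw [SCSP.height]
    have := ih hs.1 t ht
    exact ⟨this.1, by omega⟩
  | ext_r _ ih =>
    intro t ht
    rw [SCSP.ParFree] at hs
    rw [SCSP.height]
    have := ih hs.2 t ht
    exact ⟨this.1, by omega⟩
  | ext_i_l _ ih =>
    intro t ht
    rw [SCSP.ParFree] at hs
    obtain ⟨u, hu, rfl⟩ := exists_of_weights_map_ne_zero _ _ ht
    have := ih hs.1 u hu
    simp only [SCSP.ParFree, SCSP.height]
    exact ⟨⟨this.1, hs.2⟩, by omega⟩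
  | ext_i_r _ ih =>
    intro t ht
    rw [SCSP.ParFree] at hs
    obtain ⟨u, hu, rfl⟩ := exists_of_weights_map_ne_zero _ _ ht
    have := ih hs.2 u hu
    simp only [SCSP.ParFree, SCSP.height]
    exact ⟨⟨hs.1, this.1⟩, by omega⟩
  | par_l | par_r | par_i => simp [SCSP.ParFree] at hs

theorem Step.parFreeDist {s : SCSP Act} {α : Label Act} {Δ : FDist (SCSP Act)}
    (h : Step s α Δ) (hs : s.ParFree) : ParFreeDist Δ := fun t ht => (h.parFree_height hs t ht).1

theorem Lift.parFreeDist {R : SCSP Act → FDist (SCSP Act) → Prop}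
    (hR : ∀ s Φ, R s Φ → s.ParFree → ParFreeDist Φ) {Δ Θ : FDist (SCSP Act)} (h : Lift R Δ Θ)
    (hΔ : ParFreeDist Δ) : ParFreeDist Θ := by
  refine Lift.induction (C := fun Δ Θ => ParFreeDist Δ → ParFreeDist Θ) (BiConvex.of_prob ?_)
    (fun s Φ h hs => hR s Φ h (parFreeDist_single.1 hs)) h hΔ
  simp only [parFreeDist_pair]
  exact fun p _ _ _ _ _ _ _ h₁ h₂ h => ⟨h₁ h.1, h₂ h.2⟩

theorem HatTau.parFreeDist {s : SCSP Act} {Φ : FDist (SCSP Act)} (h : HatTau s Φ)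
    (hs : s.ParFree) : ParFreeDist Φ := by
  rcases h with h | rfl
  · exact h.parFreeDist hs
  · simpa using hs

theorem WeakTau.parFreeDist {Δ Θ : FDist (SCSP Act)} (h : WeakTau Δ Θ) (hΔ : ParFreeDist Δ) :
    ParFreeDist Θ := by
  induction h with
  | refl => exact hΔ
  | tail _ h ih => exact h.parFreeDist (fun _ _ h => h.parFreeDist) ih

/-- This converse of `Step.mem_inits` turns operational refusals into the side condition of Must2.
-/
theorem SCSP.exists_step_of_mem_inits {s : SCSP Act} (hs : s.ParFree) {α : Label Act}
    (h : α ∈ s.inits) : ∃ Δ, Step s α Δ := by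
  match s with
  | .nil => simp [SCSP.inits] at h
  | .pre a P =>
    obtain rfl : α = some a := by simpa [SCSP.inits] using h
    exact ⟨_, .action a P⟩
  | .int P Q =>
    obtain rfl : α = none := by simpa [SCSP.inits] using h
    exact ⟨_, .int_l P Q⟩
  | .ext s t =>
    rw [SCSP.ParFree] at hs
    rw [SCSP.inits] at h
    rcases h with h | h
    · obtain ⟨Δ, h⟩ := SCSP.exists_step_of_mem_inits hs.1 h
      cases α with
      | none => exact ⟨_, .ext_i_l h⟩
      | some a => exact ⟨_, .ext_l h⟩
    · obtain ⟨Δ, h⟩ := SCSP.exists_step_of_mem_inits hs.2 h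
      cases α with
      | none => exact ⟨_, .ext_i_r h⟩
      | some a => exact ⟨_, .ext_r h⟩
  | .par _ _ _ => simp [SCSP.ParFree] at hs

theorem PCSP.exists_of_mem_inits {P : PCSP Act} {α : Label Act} (h : α ∈ P.inits) :
    ∃ s, P.den.weights s ≠ 0 ∧ α ∈ s.inits := by
  match P with
  | .state s => exact ⟨s, by simp [PCSP.den], by rwa [PCSP.inits] at h⟩
  | .prob p P Q =>
    rw [PCSP.inits] at h
    rcases h with h | h
    · obtain ⟨s, hs, h⟩ := PCSP.exists_of_mem_inits h
      exact ⟨s, (weights_pair_ne_zero p).2 (Or.inl hs), h⟩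
    · obtain ⟨s, hs, h⟩ := PCSP.exists_of_mem_inits h
      exact ⟨s, (weights_pair_ne_zero p).2 (Or.inr hs), h⟩

end ParFree

/-! ## Theories in which internal choice is an upper bound -/

section Theory

variable {Act : Type*}

/-- A precongruence on nCSP that satisfies the common equations and in which internal choice is an
upper bound: the may theory, and the opposite of the must theory. -/
structure ChoiceTheory (r : PCSP Act → PCSP Act → Prop) : Prop where
  left_mem : ∀ {P Q}, r P Q → P.ParFree
  right_mem : ∀ {P Q}, r P Q → Q.ParFree
  refl : ∀ {P}, P.ParFree → r P P
  trans : ∀ {P Q R}, r P Q → r Q R → r P R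
  pre : ∀ (a : Act) {P Q}, r P Q → r (.pre a P) (.pre a Q)
  int : ∀ {P P' Q Q'}, r P P' → r Q Q' → r (.int P Q) (.int P' Q')
  ext : ∀ {P P' Q Q'}, r P P' → r Q Q' → r (.ext P Q) (.ext P' Q')
  prob : ∀ (p : Prb) {P P' Q Q'}, r P P' → r Q Q' → r (.prob p P Q) (.prob p P' Q')
  common : ∀ {P Q}, CommonEq P Q → P.ParFree → Q.ParFree → r P Q ∧ r Q P
  int_left : ∀ {P Q}, P.ParFree → Q.ParFree → r P (.int P Q)

theorem Derivable.mem {Ax : PCSP Act → PCSP Act → Prop} {P Q : PCSP Act} (h : Derivable Ax P Q) :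
    P.ParFree ∧ Q.ParFree := by
  induction h with
  | ax hP hQ _ => exact ⟨hP, hQ⟩
  | refl hP => exact ⟨hP, hP⟩
  | trans _ _ ih ih' => exact ⟨ih.1, ih'.2⟩
  | pre a _ ih => simpa using ih
  | int _ _ ih ih' => simp [*]
  | ext _ _ ih ih' => simp [*]
  | prob p _ _ ih ih' => simp [*]

theorem choiceTheory_may : ChoiceTheory (MayDerivable (Act := Act)) where
  left_mem h := h.mem.1
  right_mem h := h.mem.2
  refl h := .refl h
  trans h h' := .trans h h'
  pre a _ _ h := .pre a h
  int h h' := .int h h'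
  ext h h' := .ext h h'
  prob p _ _ _ _ h h' := .prob p h h'
  common h hP hQ := ⟨.ax hP hQ (.eq h), .ax hQ hP (.eq_symm h)⟩
  int_left hP hQ := .ax hP (PCSP.parFree_int.2 ⟨hP, hQ⟩) (.may1 _ _)

theorem choiceTheory_must : ChoiceTheory fun P Q : PCSP Act => MustDerivable Q P where
  left_mem h := h.mem.2
  right_mem h := h.mem.1
  refl h := .refl h
  trans h h' := .trans h' h
  pre a _ _ h := .pre a h
  int h h' := .int h h'
  ext h h' := .ext h h'
  prob p _ _ _ _ h h' := .prob p h h'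
  common h hP hQ := ⟨.ax hQ hP (.eq_symm h), .ax hP hQ (.eq h)⟩
  int_left {P Q} hP hQ := .trans
    (.ax (PCSP.parFree_int.2 ⟨hP, hQ⟩) (PCSP.parFree_int.2 ⟨hQ, hP⟩) (.eq (.i2 P Q)))
    (.ax (PCSP.parFree_int.2 ⟨hQ, hP⟩) hP (.must1 _ _))

/-- The ordering of distributions induced by an ordering of terms. -/
def DistLE (r : PCSP Act → PCSP Act → Prop) (Δ Θ : FDist (SCSP Act)) : Prop :=
  ∃ P Q, r P Q ∧ P.den = Δ ∧ Q.den = Θ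

namespace ChoiceTheory

variable {r : PCSP Act → PCSP Act → Prop} (T : ChoiceTheory r)

include T

theorem int_right {P Q : PCSP Act} (hP : P.ParFree) (hQ : Q.ParFree) : r Q (.int P Q) :=
  T.trans (T.int_left hQ hP) (T.common (.i2 Q P) (by simp [*]) (by simp [*])).1

theorem int_le {P Q R : PCSP Act} (h : r P R) (h' : r Q R) : r (.int P Q) R :=
  T.trans (T.int h h') (T.common (.i1 R) (by simp [T.right_mem h]) (T.right_mem h)).1

theorem ext_nil {P : PCSP Act} (hP : P.ParFree) : r (P.ext .nil) P ∧ r P (P.ext .nil) :=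
  T.common (.e1 P) (by simp [*]) hP

theorem ext_comm {P Q : PCSP Act} (hP : P.ParFree) (hQ : Q.ParFree) : r (P.ext Q) (Q.ext P) :=
  (T.common (.e2 P Q) (by simp [*]) (by simp [*])).1

theorem ext_assoc {P Q R : PCSP Act} (hP : P.ParFree) (hQ : Q.ParFree) (hR : R.ParFree) :
    r ((P.ext Q).ext R) (P.ext (Q.ext R)) ∧ r (P.ext (Q.ext R)) ((P.ext Q).ext R) :=
  T.common (.e3 P Q R) (by simp [*]) (by simp [*])

/-- Terms with the same denotation are provably equal. -/
theorem of_den_eq {P Q : PCSP Act} (hP : P.ParFree) (hQ : Q.ParFree) (h : P.den = Q.den) :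
    r P Q := by
  -- The classes modulo provable equality form a barycentric algebra by P1, P2 and P3.
  let st : Setoid {P : PCSP Act // P.ParFree} :=
    { r := fun P Q => r P Q ∧ r Q P
      iseqv := ⟨fun P => ⟨T.refl P.2, T.refl P.2⟩, And.symm,
        fun h h' => ⟨T.trans h.1 h'.1, T.trans h'.2 h.2⟩⟩ }
  let mix (p : Prb) : Quotient st → Quotient st → Quotient st :=
    Quotient.map₂ (fun P Q => ⟨.prob p P Q, PCSP.parFree_prob.2 ⟨P.2, Q.2⟩⟩)
      fun _ _ h _ _ h' => ⟨T.prob p h.1 h'.1, T.prob p h.2 h'.2⟩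
  let inst : Barycentric (Quotient st) :=
    { mix := mix
      mix_self := by
        rintro p ⟨P, hP⟩
        exact Quotient.sound (T.common (.p1 p P) (by simp [*]) hP)
      mix_compl := by
        rintro p ⟨P, hP⟩ ⟨Q, hQ⟩
        exact Quotient.sound (T.common (.p2 p P Q) (by simp [*]) (by simp [*]))
      mix_assoc := by
        rintro p q ⟨P, hP⟩ ⟨Q, hQ⟩ ⟨R, hR⟩
        exact Quotient.sound (T.common (.p3 p q P Q R) (by simp [*]) (by simp [*])) }
  classical
  let f : SCSP Act → Quotient st := fun s =>
    if hs : s.ParFree then ⟦⟨.state s, PCSP.parFree_state.2 hs⟩⟧ else ⟦⟨.nil, PCSP.parFree_nil⟩⟧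
  -- Evaluating a term in this algebra returns its own class, so equality of values is provable
  -- equality. Evaluation only inspects the top choices, hence the trivial motive for states.
  have key : ∀ (P : PCSP Act) (hP : P.ParFree), P.eval f = ⟦⟨P, hP⟩⟧ := by
    intro P
    refine PCSP.rec (motive_1 := fun P => ∀ hP : P.ParFree, P.eval f = ⟦⟨P, hP⟩⟧)
      (motive_2 := fun _ => True) ?_ ?_ trivial (fun _ _ _ => trivial) (fun _ _ _ _ => trivial)
      (fun _ _ _ _ => trivial) (fun _ _ _ _ _ => trivial) P
    · intro s _ hs
      exact dif_pos (PCSP.parFree_state.1 hs)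
    · intro p P Q ihP ihQ h
      obtain ⟨hP, hQ⟩ := PCSP.parFree_prob.1 h
      rw [PCSP.eval, ihP hP, ihQ hQ]
      rfl
  have := PCSP.eval_eq_of_den_eq f h
  rw [key P hP, key Q hQ] at this
  exact (Quotient.exact this).1

/-- By `of_den_eq`, the choice of representing terms is immaterial, so passing to distributions
loses no information about the theory. -/
theorem distLE_iff {P Q : PCSP Act} : DistLE r P.den Q.den ↔ r P Q := by
  refine ⟨?_, fun h => ⟨P, Q, h, rfl, rfl⟩⟩
  rintro ⟨P', Q', h, hP, hQ⟩
  have hP' := T.left_mem h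
  have hQ' := T.right_mem h
  have hP'' : P.ParFree := parFreeDist_den.1 (hP ▸ parFreeDist_den.2 hP')
  have hQ'' : Q.ParFree := parFreeDist_den.1 (hQ ▸ parFreeDist_den.2 hQ')
  exact T.trans (T.of_den_eq hP'' hP' hP.symm) (T.trans h (T.of_den_eq hQ' hQ'' hQ))

theorem distLE_trans {Δ Θ Φ : FDist (SCSP Act)} (h : DistLE r Δ Θ) (h' : DistLE r Θ Φ) :
    DistLE r Δ Φ := by
  obtain ⟨P, Q, h, rfl, rfl⟩ := h
  obtain ⟨Q', R, h', hQ, rfl⟩ := h'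
  exact ⟨P, R, T.trans h (T.trans (T.of_den_eq (T.right_mem h) (T.left_mem h') hQ.symm) h'),
    rfl, rfl⟩

theorem distLE_refl {Δ : FDist (SCSP Act)} (h : ParFreeDist Δ) : DistLE r Δ Δ := by
  obtain ⟨P, hP, rfl⟩ := exists_den_eq h
  exact ⟨P, P, T.refl hP, rfl, rfl⟩

theorem distLE_biConvex : BiConvex (DistLE r) := by
  refine BiConvex.of_prob ?_
  rintro p _ _ _ _ _ _ _ ⟨P, Q, h, rfl, rfl⟩ ⟨P', Q', h', rfl, rfl⟩
  exact ⟨_, _, T.prob p h h', rfl, rfl⟩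

/-! ### Derivatives -/

/-- At the root of the step, ⊓ is an upper bound of its arguments. The inequality then passes
through the surrounding □ by congruence. -/
theorem distLE_of_step {s : SCSP Act} {α : Label Act} {Δ : FDist (SCSP Act)} (h : Step s α Δ)
    (hs : s.ParFree) (hα : α = none) : DistLE r Δ (StdSimplex.single s) := by
  induction h with
  | action => cases hα
  | int_l P Q =>
    rw [SCSP.ParFree] at hs
    exact ⟨_, _, T.int_left hs.1 hs.2, rfl, rfl⟩
  | int_r P Q =>
    rw [SCSP.ParFree] at hs
    exact ⟨_, _, T.int_right hs.1 hs.2, rfl, rfl⟩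
  | ext_l => cases hα
  | ext_r => cases hα
  | @ext_i_l s t Δ _ ih =>
    rw [SCSP.ParFree] at hs
    obtain ⟨P, Q, h, rfl, hQ⟩ := ih hs.1 rfl
    refine ⟨_, _, T.ext h (T.refl (P := .state t) (by simp [hs.2])), ?_, ?_⟩
    · rw [PCSP.den_ext, PCSP.den, extDist_single_right]
    · rw [PCSP.den_ext, PCSP.den, extDist_single_right, hQ, StdSimplex.map_single]
  | @ext_i_r s t Δ _ ih =>
    rw [SCSP.ParFree] at hs
    obtain ⟨P, Q, h, rfl, hQ⟩ := ih hs.2 rfl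
    refine ⟨_, _, T.ext (T.refl (P := .state s) (by simp [hs.1])) h, ?_, ?_⟩
    · rw [PCSP.den_ext, PCSP.den, extDist_single_left]
    · rw [PCSP.den_ext, PCSP.den, extDist_single_left, hQ, StdSimplex.map_single]
  | par_l | par_r | par_i => simp [SCSP.ParFree] at hs

theorem distLE_of_weakTau {Δ Θ : FDist (SCSP Act)} (h : WeakTau Δ Θ) (hΔ : ParFreeDist Δ) :
    DistLE r Θ Δ := by
  induction h with
  | refl => exact T.distLE_refl hΔ
  | @tail Θ Φ hw h ih =>
    refine T.distLE_trans ?_ ih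
    refine Lift.induction (C := fun Δ Θ => ParFreeDist Δ → DistLE r Θ Δ) (BiConvex.of_prob ?_) ?_ h
      (WeakTau.parFreeDist hw hΔ)
    · simp only [parFreeDist_pair]
      exact fun p h₁ h₂ h₃ _ _ _ _ h h' H => T.distLE_biConvex _ _ h₁ h₂ h₃ _ _ _ _ (h H.1) (h' H.2)
    · rintro s Φ (hs | rfl) H
      · exact T.distLE_of_step hs (parFreeDist_single.1 H) rfl
      · exact T.distLE_refl H

/-- A state that can perform `a` has the shape `a.Q □ P`. -/
theorem exists_ext_pre {s : SCSP Act} {α : Label Act} {Δ : FDist (SCSP Act)} (h : Step s α Δ)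
    (hs : s.ParFree) {a : Act} (hα : α = some a) : ∃ Q P : PCSP Act, Q.ParFree ∧ P.ParFree ∧
      Q.den = Δ ∧ r ((PCSP.pre a Q).ext P) (.state s) := by
  induction h with
  | action b P =>
    obtain rfl : b = a := Option.some.inj hα
    rw [SCSP.ParFree] at hs
    exact ⟨P, .nil, hs, by simp, rfl, (T.ext_nil (P := .pre b P) (by simp [hs])).1⟩
  | @ext_l s t _ _ _ ih =>
    rw [SCSP.ParFree] at hs
    obtain ⟨Q, P, hQ, hP, rfl, h⟩ := ih hs.1 hα
    have ht : (PCSP.state t).ParFree := by simp [hs.2]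
    exact ⟨Q, P.ext (.state t), hQ, by simp [*], rfl,
      T.trans (T.ext_assoc (by simp [*]) hP ht).2 (T.ext h (T.refl ht))⟩
  | @ext_r s t _ _ _ ih =>
    rw [SCSP.ParFree] at hs
    obtain ⟨Q, P, hQ, hP, rfl, h⟩ := ih hs.2 hα
    have ht : (PCSP.state s).ParFree := by simp [hs.1]
    exact ⟨Q, P.ext (.state s), hQ, by simp [*], rfl,
      T.trans (T.trans (T.ext_assoc (by simp [*]) hP ht).2 (T.ext h (T.refl ht)))
        (T.ext_comm (by simp [*]) ht)⟩
  | par_l | par_r | par_i => simp [SCSP.ParFree] at hs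
  | _ => cases hα

end ChoiceTheory

/-! ### Head normal forms -/

/-- Iterated internal choices of terms from `D`. -/
inductive IntTree (D : PCSP Act → Prop) : PCSP Act → Prop
  | leaf {P} : D P → IntTree D P
  | node {P Q} : IntTree D P → IntTree D Q → IntTree D (.int P Q)

/-- `P` is below an iterated internal choice of terms from `D`. -/
def BelowInt (r : PCSP Act → PCSP Act → Prop) (D : PCSP Act → Prop) (P : PCSP Act) : Prop :=
  ∃ Q, IntTree D Q ∧ r P Q

/-- The terms of nCSP that denote `τ`-derivatives of `s`. -/
def TauDer (s : SCSP Act) (P : PCSP Act) : Prop := P.ParFree ∧ Step s none P.den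

theorem tauDer_ext_left {s t : SCSP Act} {P : PCSP Act} (h : TauDer s P) (ht : t.ParFree) :
    TauDer (.ext s t) (P.ext (.state t)) := by
  refine ⟨by simp [h.1, ht], ?_⟩
  rw [PCSP.den_ext, PCSP.den, extDist_single_right]
  exact .ext_i_l h.2

theorem tauDer_ext_right {s t : SCSP Act} {P : PCSP Act} (h : TauDer s P) (ht : t.ParFree) :
    TauDer (.ext t s) (PCSP.ext (.state t) P) := by
  refine ⟨by simp [h.1, ht], ?_⟩
  rw [PCSP.den_ext, PCSP.den, extDist_single_left]
  exact .ext_i_r h.2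

/-- The external choice of a list of prefixes. -/
def extList : List (Act × PCSP Act) → PCSP Act
  | [] => .nil
  | x :: X => (PCSP.pre x.1 x.2).ext (extList X)

theorem parFree_extList {X : List (Act × PCSP Act)} (h : ∀ x ∈ X, x.2.ParFree) :
    (extList X).ParFree := by
  induction X with
  | nil => simp [extList]
  | cons x X ih =>
    simp only [List.mem_cons, forall_eq_or_imp] at h
    simp [extList, h.1, ih h.2]

namespace ChoiceTheory

variable {r : PCSP Act → PCSP Act → Prop} (T : ChoiceTheory r)

include T

theorem intTree_le {D : PCSP Act → Prop} {P R : PCSP Act} (h : IntTree D P)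
    (hD : ∀ Q, D Q → r Q R) : r P R := by
  induction h with
  | leaf h => exact hD _ h
  | node _ _ ih ih' => exact T.int_le ih ih'

theorem belowInt_le {D : PCSP Act → Prop} {P R : PCSP Act} (h : BelowInt r D P)
    (hD : ∀ Q, D Q → r Q R) : r P R :=
  let ⟨_, hQ, h⟩ := h
  T.trans h (T.intTree_le hQ hD)

theorem belowInt_trans {D : PCSP Act → Prop} {P Q : PCSP Act} (h : r P Q) (h' : BelowInt r D Q) :
    BelowInt r D P :=
  let ⟨R, hR, h'⟩ := h'
  ⟨R, hR, T.trans h h'⟩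

theorem belowInt_int {D : PCSP Act → Prop} {P Q : PCSP Act} (h : BelowInt r D P)
    (h' : BelowInt r D Q) : BelowInt r D (.int P Q) :=
  let ⟨_, hR, h⟩ := h
  let ⟨_, hR', h'⟩ := h'
  ⟨_, .node hR hR', T.int h h'⟩

theorem tauDer_le {s : SCSP Act} (hs : s.ParFree) {P : PCSP Act} (h : TauDer s P) :
    r P (.state s) :=
  T.distLE_iff.1 (T.distLE_of_step h.2 hs rfl)

/-- D3 replaces P □ Q by four terms in which one of the two trees has shrunk while the other is kept
whole, so the inductions on the trees are nested. When one tree is a leaf, the other is bounded by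
its state, which gives a genuine τ-derivative of s □ t. -/
theorem belowInt_ext_ext {s t : SCSP Act} (hs : s.ParFree) (ht : t.ParFree) {P Q : PCSP Act}
    (hP : IntTree (TauDer s) P) (hQ : IntTree (TauDer t) Q) :
    BelowInt r (TauDer (.ext s t)) (P.ext Q) := by
  have hle {s : SCSP Act} (hs : s.ParFree) {P : PCSP Act} (hP : IntTree (TauDer s) P) :
      r P (.state s) := T.intTree_le hP fun Q hQ => T.tauDer_le hs hQ
  induction hP generalizing Q with
  | leaf hP => exact ⟨_, .leaf (tauDer_ext_left hP ht), T.ext (T.refl hP.1) (hle ht hQ)⟩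
  | @node P₁ P₂ hP₁ hP₂ ih₁ ih₂ =>
    induction hQ with
    | leaf hQ =>
      exact ⟨_, .leaf (tauDer_ext_right hQ hs), T.ext (hle hs (.node hP₁ hP₂)) (T.refl hQ.1)⟩
    | @node Q₁ Q₂ hQ₁ hQ₂ ih₁' ih₂' =>
      have m₁ := T.left_mem (hle hs hP₁)
      have m₂ := T.left_mem (hle hs hP₂)
      have m₃ := T.left_mem (hle ht hQ₁)
      have m₄ := T.left_mem (hle ht hQ₂)
      exact T.belowInt_trans (T.common (.d3 P₁ P₂ Q₁ Q₂) (by simp [*]) (by simp [*])).1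
        (T.belowInt_int (T.belowInt_int (T.belowInt_int (ih₁ (.node hQ₁ hQ₂))
          (ih₂ (.node hQ₁ hQ₂))) ih₁') ih₂')

/-- D2 applies to one prefix at a time; associativity peels the prefixes off the list. -/
theorem extList_ext_int {X : List (Act × PCSP Act)} (hX : ∀ x ∈ X, x.2.ParFree) {P Q : PCSP Act}
    (hP : P.ParFree) (hQ : Q.ParFree) :
    r ((extList X).ext (.int P Q)) (.int ((extList X).ext P) ((extList X).ext Q)) := by
  induction X with
  | nil =>
    have hnil {P : PCSP Act} (hP : P.ParFree) :
        r (PCSP.nil.ext P) P ∧ r P (PCSP.nil.ext P) :=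
      ⟨T.trans (T.ext_comm (by simp) hP) (T.ext_nil hP).1,
        T.trans (T.ext_nil hP).2 (T.ext_comm hP (by simp))⟩
    exact T.trans (hnil (by simp [*])).1 (T.int (hnil hP).2 (hnil hQ).2)
  | cons x X ih =>
    have hX' : ∀ x ∈ X, x.2.ParFree := fun y hy => hX y (List.mem_cons_of_mem _ hy)
    have hx : x.2.ParFree := hX x List.mem_cons_self
    have hl := parFree_extList hX'
    have hpre : (PCSP.pre x.1 x.2).ParFree := by simp [hx]
    rw [extList]
    refine T.trans (T.ext_assoc hpre hl (by simp [*])).1 ?_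
    refine T.trans (T.ext (T.refl hpre) (ih hX')) ?_
    refine T.trans (T.common (.d2 x.1 x.2 _ _) (by simp [*]) (by simp [*])).1 ?_
    exact T.int (T.ext_assoc hpre hl hP).2 (T.ext_assoc hpre hl hQ).2

theorem ext_extList_append {X Y : List (Act × PCSP Act)} (hX : ∀ x ∈ X, x.2.ParFree)
    (hY : ∀ x ∈ Y, x.2.ParFree) :
    r ((extList X).ext (extList Y)) (extList (X ++ Y)) ∧
      r (extList (X ++ Y)) ((extList X).ext (extList Y)) := by
  have hl' := parFree_extList hY
  induction X with
  | nil =>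
    exact ⟨T.trans (T.ext_comm (by simp [extList]) hl') (T.ext_nil hl').1,
      T.trans (T.ext_nil hl').2 (T.ext_comm hl' (by simp))⟩
  | cons x X ih =>
    have hX' : ∀ x ∈ X, x.2.ParFree := fun y hy => hX y (List.mem_cons_of_mem _ hy)
    have hx : x.2.ParFree := hX x List.mem_cons_self
    have hl := parFree_extList hX'
    have hpre : (PCSP.pre x.1 x.2).ParFree := by simp [hx]
    rw [List.cons_append, extList, extList]
    exact ⟨T.trans (T.ext_assoc hpre hl hl').1 (T.ext (T.refl hpre) (ih hX').1),
      T.trans (T.ext (T.refl hpre) (ih hX').2) (T.ext_assoc hpre hl hl').2⟩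

theorem belowInt_ext_extList {D : PCSP Act → Prop} {X : List (Act × PCSP Act)}
    (hX : ∀ x ∈ X, x.2.ParFree) {s : SCSP Act} {P : PCSP Act} (hP : IntTree (TauDer s) P)
    (hD : ∀ Q, TauDer s Q → BelowInt r D (Q.ext (extList X))) :
    BelowInt r D (P.ext (extList X)) := by
  have hl := parFree_extList hX
  have hmem {P : PCSP Act} (hP : IntTree (TauDer s) P) : P.ParFree := by
    induction hP with
    | leaf h => exact h.1
    | node _ _ ih ih' => simp [*]
  induction hP with
  | leaf h => exact hD _ h
  | node h h' ih ih' =>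
    have m := hmem h
    have m' := hmem h'
    refine T.belowInt_trans ?_ (T.belowInt_int ih ih')
    refine T.trans (T.ext_comm (by simp [*]) hl) ?_
    exact T.trans (T.extList_ext_int hX m m') (T.int (T.ext_comm hl m) (T.ext_comm hl m'))

/-- Every state is provably an external choice of prefixes, its transitions, or below an internal
choice of its `τ`-derivatives. -/
theorem head_normal_form {s : SCSP Act} (hs : s.ParFree) :
    BelowInt r (TauDer s) (.state s) ∨
    ∃ X : List (Act × PCSP Act), (∀ x ∈ X, x.2.ParFree ∧ Step s (some x.1) x.2.den) ∧
      r (.state s) (extList X) ∧ r (extList X) (.state s) ∧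
      ∀ α Δ, Step s α Δ → ∃ x ∈ X, α = some x.1 := by
  match s with
  | .nil =>
    exact Or.inr ⟨[], by simp, T.refl (P := .nil) (by simp), T.refl (P := .nil) (by simp),
      fun _ _ h => (Step.not_nil h).elim⟩
  | .pre a P =>
    rw [SCSP.ParFree] at hs
    have h := T.ext_nil (P := .pre a P) (by simp [hs])
    refine Or.inr ⟨[(a, P)], by simpa [hs] using Step.action a P, h.2, h.1, fun _ _ h => ?_⟩
    simpa using (Step.pre_iff.1 h).1
  | .int P Q =>
    rw [SCSP.ParFree] at hs
    exact Or.inl ⟨_, .node (.leaf ⟨hs.1, .int_l P Q⟩) (.leaf ⟨hs.2, .int_r P Q⟩),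
      T.refl (P := .int P Q) (by simp [hs])⟩
  | .ext s t =>
    rw [SCSP.ParFree] at hs
    obtain ⟨hs, ht⟩ := hs
    have ms : (PCSP.state s).ParFree := by simp [hs]
    have mt : (PCSP.state t).ParFree := by simp [ht]
    have hcomm : r (.state (.ext s t)) (.state (.ext t s)) := T.ext_comm ms mt
    -- Two unstable components are handled by D3, and one unstable component against prefixes by D2.
    -- For two stable components the lists of prefixes are concatenated.
    rcases head_normal_form hs with ⟨P, hP, hsP⟩ | ⟨X, hX, hsX, hXs, hX'⟩ <;>
      rcases head_normal_form ht with ⟨Q, hQ, htQ⟩ | ⟨Y, hY, htY, hYt, hY'⟩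
    · exact Or.inl (T.belowInt_trans (T.ext hsP htQ) (T.belowInt_ext_ext hs ht hP hQ))
    · refine Or.inl (T.belowInt_trans (T.ext hsP htY) ?_)
      refine T.belowInt_ext_extList (fun x hx => (hY x hx).1) hP fun R hR => ?_
      exact ⟨_, .leaf (tauDer_ext_left hR ht), T.ext (T.refl hR.1) hYt⟩
    · refine Or.inl (T.belowInt_trans (T.trans hcomm (T.ext htQ hsX)) ?_)
      refine T.belowInt_ext_extList (fun x hx => (hX x hx).1) hQ fun R hR => ?_
      exact ⟨_, .leaf (tauDer_ext_right hR hs),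
        T.trans (T.ext (T.refl hR.1) hXs) (T.ext_comm hR.1 ms)⟩
    · have happ := T.ext_extList_append (fun x hx => (hX x hx).1) (fun x hx => (hY x hx).1)
      refine Or.inr ⟨X ++ Y, ?_, T.trans (T.ext hsX htY) happ.1,
        T.trans happ.2 (T.ext hXs hYt), ?_⟩
      · intro x hx
        rcases List.mem_append.1 hx with hx | hx
        · exact ⟨(hX x hx).1, .ext_l (hX x hx).2⟩
        · exact ⟨(hY x hx).1, .ext_r (hY x hx).2⟩
      · intro α Δ h
        have of_l {α Δ} (h : Step s α Δ) : ∃ x ∈ X ++ Y, α = some x.1 :=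
          let ⟨x, hx, h⟩ := hX' α Δ h
          ⟨x, List.mem_append_left _ hx, h⟩
        have of_r {α Δ} (h : Step t α Δ) : ∃ x ∈ X ++ Y, α = some x.1 :=
          let ⟨x, hx, h⟩ := hY' α Δ h
          ⟨x, List.mem_append_right _ hx, h⟩
        obtain ⟨a, rfl, h' | h'⟩ | ⟨rfl, ⟨_, h', _⟩ | ⟨_, h', _⟩⟩ := h.ext_cases
        exacts [of_l h', of_r h', of_l h', of_r h']
  | .par _ _ _ => simp [SCSP.ParFree] at hs

end ChoiceTheory

end Theory

/-! ## Completeness -/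

section Completeness

variable {Act : Type*}

namespace PCSP

/-- Multiplying by the total weight avoids normalization, so the induction can pass to the tail of
the family, whose weights no longer add up to 1. -/
theorem weights_den_bigProb : ∀ (n : ℕ) (w : Fin (n + 1) → ℝ) (hw : ∀ i, 0 < w i)
    (P : Fin (n + 1) → PCSP Act),
    (∑ i, w i) • (bigProb n w hw P).den.weights = ∑ i, w i • (P i).den.weights
  | 0, _, _, _ => by simp [bigProb]
  | n + 1, w, hw, P => by
    have h := weights_den_bigProb n (fun i => w i.succ) (fun i => hw i.succ) fun i => P i.succ
    have hpos : 0 < ∑ i, w i := Finset.sum_pos (fun i _ => hw i) Finset.univ_nonempty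
    rw [bigProb, den, StdSimplex.weights_convexCombPair, Fin.sum_univ_succ (fun i => w i • _), ← h,
      _root_.smul_add, smul_smul, smul_smul, mul_div_cancel₀ _ hpos.ne', mul_sub, mul_one,
      mul_div_cancel₀ _ hpos.ne', Fin.sum_univ_succ w, add_sub_cancel_left]

theorem den_bigProb {n : ℕ} (q : FDist (Fin (n + 1))) (hq : ∀ i, 0 < q.weights i)
    (P : Fin (n + 1) → PCSP Act) :
    (bigProb n q.weights hq P).den = q.iConvexComb fun i => (P i).den := by
  have h := weights_den_bigProb n q.weights hq P
  have hq' : ∑ i, q.weights i = 1 := by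
    rw [← q.total, Finsupp.sum_fintype _ _ fun _ => rfl]
  rw [hq', one_smul] at h
  ext s
  rw [h, weights_iConvexComb_fdist, Finsupp.sum_fintype _ _ (by simp)]

end PCSP

namespace ChoiceTheory

variable {r : PCSP Act → PCSP Act → Prop} (T : ChoiceTheory r)

include T

theorem bigInt_le {R : PCSP Act} : ∀ (n : ℕ) (P : Fin (n + 1) → PCSP Act), (∀ i, r (P i) R) →
    r (PCSP.bigInt n P) R
  | 0, _, h => h 0
  | n + 1, _, h => T.int_le (h 0) (bigInt_le n _ fun i => h i.succ)

theorem intFamily_le {R R' : PCSP Act} (hR : r R' R) : ∀ (n : ℕ) (P : Fin n → PCSP Act),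
    (∀ i, r (P i) R) → r (PCSP.intFamily R' n P) R
  | 0, _, _ => hR
  | n + 1, P, h => T.int_le hR (T.bigInt_le n P h)

theorem bigExt_mono : ∀ (n : ℕ) (P Q : Fin n → PCSP Act), (∀ i, r (P i) (Q i)) →
    r (PCSP.bigExt n P) (PCSP.bigExt n Q)
  | 0, _, _, _ => T.refl (P := .nil) (by simp)
  | 1, _, _, h => h 0
  | n + 2, _, _, h => T.ext (h 0) (bigExt_mono (n + 1) _ _ fun i => h i.succ)

theorem extList_le_bigExt : ∀ X : List (Act × PCSP Act), (∀ x ∈ X, x.2.ParFree) →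
    r (extList X) (PCSP.bigExt X.length fun i => PCSP.pre (X.get i).1 (X.get i).2)
  | [], _ => T.refl (P := .nil) (by simp)
  | [x], h => (T.ext_nil (P := .pre x.1 x.2) (by simpa using h)).1
  | x :: y :: X, h =>
    T.ext (T.refl (P := .pre x.1 x.2) (by simpa using h x List.mem_cons_self))
      (extList_le_bigExt (y :: X) fun z hz => h z (List.mem_cons_of_mem _ hz))

/-- If the stable states are dealt with, simulation implies provable inequality. -/
theorem distLE_of_genBy {b : Prop}
    (stable : ∀ (s : SCSP Act) (X : List (Act × PCSP Act)) (Θ : FDist (SCSP Act)), s.ParFree →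
      ParFreeDist Θ → (∀ x ∈ X, x.2.ParFree) → r (.state s) (extList X) →
      (b → s.Refuses {a | ∀ x ∈ X, a ≠ x.1}) →
      (b → ∀ X, s.Refuses X → ∃ Θ', WeakTau Θ Θ' ∧ RefusesDist Θ' X) →
      (∀ x ∈ X, ∃ Θ', Weak (some x.1) Θ Θ' ∧ DistLE r x.2.den Θ') →
      DistLE r (StdSimplex.single s) Θ) :
    ∀ (n : ℕ) (s : SCSP Act) (Θ : FDist (SCSP Act)), s.height < n → s.ParFree → ParFreeDist Θ →
      GenBy b s Θ → DistLE r (StdSimplex.single s) Θ := by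
  intro n
  induction n with
  | zero => exact fun s Θ h => absurd h (Nat.not_lt_zero _)
  | succ n ih =>
    intro s Θ hn hs hΘ h
    -- The induction hypothesis, which concerns states of smaller height, extends to lifted
    -- simulations because `DistLE r` is biconvex.
    have hlift : ∀ {α Δ Θ}, Step s α Δ → ParFreeDist Θ → Lift (GenBy b) Δ Θ → DistLE r Δ Θ := by
      intro α Δ Θ hstep hΘ hl
      have hΔ := hstep.parFree_height hs
      obtain ⟨f, hf, rfl⟩ := lift_iff.1 hl
      have := T.distLE_biConvex.iConvexComb Δ (fun t => StdSimplex.single t) f fun t ht => ?_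
      · rwa [iConvexComb_single_fun] at this
      have hft : ParFreeDist (f t) := fun u hu => hΘ u <| by
        rw [weights_iConvexComb_fdist, Finsupp.sum_apply, Finsupp.sum]
        refine (Finset.sum_pos' (fun j _ => ?_) ⟨t, by simpa using ht, ?_⟩).ne'
        · exact mul_nonneg (Δ.weights_nonneg j) ((f j).weights_nonneg u)
        · exact mul_pos (lt_of_le_of_ne (Δ.weights_nonneg t) ht.symm)
            (lt_of_le_of_ne ((f t).weights_nonneg u) hu.symm)
      have hC : BiConvex fun (_ : FDist (SCSP Act)) (Φ : FDist (SCSP Act)) =>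
          ParFreeDist Φ → DistLE r (StdSimplex.single t) Φ := by
        refine BiConvex.of_prob ?_
        intro p h₁ h₂ h₃ _ _ _ _ h h' H
        rw [parFreeDist_pair] at H
        simpa using T.distLE_biConvex _ _ h₁ h₂ h₃ _ _ _ _ (h H.1) (h' H.2)
      refine Lift.single_induction
        (C := fun Φ => ParFreeDist Φ → DistLE r (StdSimplex.single t) Φ)
        (fun a b ha hb hab Θ₁ Θ₂ => hC a b ha hb hab Δ Δ Θ₁ Θ₂) ?_ (hf t ht) hft
      intro Φ hΦ H
      exact ih t Φ (lt_of_lt_of_le (hΔ t ht).2 (Nat.le_of_lt_succ hn)) (hΔ t ht).1 H hΦ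
    rcases T.head_normal_form hs with hb | ⟨X, hX, hsX, -, hX'⟩
    · obtain ⟨R, hR, rfl⟩ := exists_den_eq hΘ
      -- Unstable case: ⊓ is a join, so it suffices to bound each τ-derivative. Each one is below
      -- its answer by `hlift`, and the answer is below `Θ` as a weak derivative.
      refine T.distLE_iff (P := .state s).2 (T.belowInt_le hb fun Q hQ => ?_)
      obtain ⟨Θ', hw, hl⟩ := h.step hQ.2
      exact T.distLE_iff.1 (T.distLE_trans (hlift hQ.2 (WeakTau.parFreeDist hw hΘ) hl)
        (T.distLE_of_weakTau hw hΘ))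
    · refine stable s X Θ hs hΘ (fun x hx => (hX x hx).1) hsX ?_ (fun hb X hX => h.refuses hb hX) ?_
      · rintro _ α hα ⟨Δ, hstep⟩
        obtain ⟨x, hx, rfl⟩ := hX' α Δ hstep
        obtain h | ⟨a, ha, h⟩ := hα
        · cases h
        · exact ha x hx (Option.some.inj h)
      · intro x hx
        obtain ⟨Θ', hw, hl⟩ := h.step (hX x hx).2
        obtain ⟨Θ₁, Θ₂, h₁, h₂, h₃⟩ := id hw
        have hΘ' := WeakTau.parFreeDist h₃
          (h₂.parFreeDist (fun _ _ h => h.parFreeDist) (h₁.parFreeDist hΘ))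
        exact ⟨Θ', hw, hlift (hX x hx).2 hΘ' hl⟩

theorem of_genLE {b : Prop}
    (h : ∀ (s : SCSP Act) (Θ : FDist (SCSP Act)), s.ParFree → ParFreeDist Θ →
      GenBy b s Θ → DistLE r (StdSimplex.single s) Θ) {P Q : PCSP Act} (hP : P.ParFree)
    (hQ : Q.ParFree) (hPQ : GenLE b P.den Q.den) : r P Q := by
  obtain ⟨Θ, hw, hl⟩ := hPQ
  refine T.distLE_iff.1 (T.distLE_trans ?_ (T.distLE_of_weakTau hw (parFreeDist_den.2 hQ)))
  refine Lift.induction (C := fun Δ Θ => ParFreeDist Δ → ParFreeDist Θ → DistLE r Δ Θ)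
    (BiConvex.of_prob ?_) ?_ hl (parFreeDist_den.2 hP) (hw.parFreeDist (parFreeDist_den.2 hQ))
  · simp only [parFreeDist_pair]
    exact fun p h₁ h₂ h₃ _ _ _ _ h h' H H' =>
      T.distLE_biConvex _ _ h₁ h₂ h₃ _ _ _ _ (h H.1 H'.1) (h' H.2 H'.2)
  · exact fun s Φ hg H H' => h s Φ (parFreeDist_single.1 H) H' hg

end ChoiceTheory

/-! ### The may theory -/

theorem mayDerivable_nil {P : PCSP Act} (hP : P.ParFree) : MayDerivable .nil P :=
  .ax (PCSP.parFree_nil (Act := Act)) hP (.may2 P)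

theorem mayDerivable_ext_left {P Q : PCSP Act} (hP : P.ParFree) (hQ : Q.ParFree) :
    MayDerivable P (P.ext Q) :=
  .trans (choiceTheory_may.ext_nil hP).2 (.ext (.refl hP) (mayDerivable_nil hQ))

theorem mayDerivable_ext_right {P Q : PCSP Act} (hP : P.ParFree) (hQ : Q.ParFree) :
    MayDerivable Q (P.ext Q) :=
  .trans (mayDerivable_ext_left hQ hP) (choiceTheory_may.ext_comm hQ hP)

/-- This extends May0 from a second prefix to a list of them. By induction the list is below an
internal choice, D2 distributes the new prefix over it, and May0 applies to the first summand. -/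
theorem mayDerivable_ext_extList (X : List (Act × PCSP Act)) (hX : ∀ x ∈ X, x.2.ParFree) (a : Act)
    {P : PCSP Act} (hP : P.ParFree) :
    MayDerivable ((PCSP.pre a P).ext (extList X)) ((PCSP.pre a P).int (extList X)) := by
  have T := choiceTheory_may (Act := Act)
  have hpre : (PCSP.pre a P).ParFree := by simp [hP]
  induction X generalizing a P with
  | nil => exact T.trans (T.ext_nil hpre).1 (T.int_left hpre PCSP.parFree_nil)
  | cons x X ih =>
    have hX' : ∀ x ∈ X, x.2.ParFree := fun y hy => hX y (List.mem_cons_of_mem _ hy)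
    have hx : (PCSP.pre x.1 x.2).ParFree := by simpa using hX x List.mem_cons_self
    have hl := parFree_extList hX'
    have hxl : ((PCSP.pre x.1 x.2).ext (extList X)).ParFree := by simp [hl, -PCSP.parFree_pre, hx]
    have hle := ih hX' x.1 (PCSP.parFree_pre.1 hx) hx
    rw [extList]
    refine T.trans (T.ext (T.refl hpre) hle) ?_
    refine T.trans (T.common (.d2 a P _ _) (by simp_all) (by simp_all)).1 ?_
    refine T.int_le ?_ ?_
    · exact T.trans (.ax (by simp_all [nCSP]) (by simp_all [nCSP]) (.may0 _ _ _ _))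
        (T.int (T.refl hpre) (mayDerivable_ext_left hx hl))
    · exact T.trans (ih hX' a hP hpre) (T.int (T.refl hpre) (mayDerivable_ext_right hx hl))

theorem mayDerivable_extList_le {X : List (Act × PCSP Act)} {R : PCSP Act} (hR : R.ParFree)
    (hX : ∀ x ∈ X, MayDerivable (PCSP.pre x.1 x.2) R) : MayDerivable (extList X) R := by
  have T := choiceTheory_may (Act := Act)
  induction X with
  | nil => exact mayDerivable_nil hR
  | cons x X ih =>
    have hX' : ∀ x ∈ X, x.2.ParFree := fun y hy =>
      PCSP.parFree_pre.1 (T.left_mem (hX y (List.mem_cons_of_mem _ hy)))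
    have hx := hX x List.mem_cons_self
    exact T.trans (mayDerivable_ext_extList X hX' x.1 (PCSP.parFree_pre.1 (T.left_mem hx)))
      (T.int_le hx (ih fun y hy => hX y (List.mem_cons_of_mem _ hy)))

/-- On a single state, dropping the remaining alternatives leaves the prefix for `a`. For mixtures,
May3 merges the prefixes into one whose continuation is the mixture of the targets. -/
theorem distLE_may_of_lift_step {a : Act} {Δ Θ : FDist (SCSP Act)}
    (h : Lift (fun s => Step s (some a)) Δ Θ) (hΔ : ParFreeDist Δ) :
    ∃ Q : PCSP Act, Q.den = Θ ∧ DistLE MayDerivable (PCSP.pre a Q).den Δ := by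
  have T := choiceTheory_may (Act := Act)
  refine Lift.induction (C := fun Δ Θ => ParFreeDist Δ →
    ∃ Q : PCSP Act, Q.den = Θ ∧ DistLE MayDerivable (PCSP.pre a Q).den Δ)
    (BiConvex.of_prob ?_) ?_ h hΔ
  · intro p h₁ h₂ h₃ _ _ _ _ h h' H
    rw [parFreeDist_pair] at H
    obtain ⟨Q, rfl, k⟩ := h H.1
    obtain ⟨Q', rfl, k'⟩ := h' H.2
    refine ⟨.prob p Q Q', rfl, T.distLE_trans ?_ (T.distLE_biConvex _ _ h₁ h₂ h₃ _ _ _ _ k k')⟩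
    have hm : ∀ {Q Δ}, DistLE MayDerivable (PCSP.pre a Q).den Δ → Q.ParFree := by
      rintro Q _ ⟨P, _, hPR, hP, _⟩
      have := parFreeDist_den.2 (T.left_mem hPR)
      rw [hP, parFreeDist_den] at this
      simpa using this
    have hQ := hm k
    have hQ' := hm k'
    exact ⟨_, _, .ax (by simp [nCSP, *]) (by simp [nCSP, *]) (.may3 a p Q Q'), rfl, rfl⟩
  · intro s Φ hs H
    obtain ⟨Q, P, hQ, hP, rfl, h⟩ := T.exists_ext_pre hs (parFreeDist_single.1 H) rfl
    exact ⟨Q, rfl, _, _, T.trans (mayDerivable_ext_left (by simp [hQ]) hP) h, rfl, rfl⟩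

theorem mayDerivable_of_genLE {P Q : PCSP Act} (hP : P.ParFree) (hQ : Q.ParFree)
    (h : GenLE False P.den Q.den) : MayDerivable P Q := by
  have T := choiceTheory_may (Act := Act)
  refine T.of_genLE (fun s Θ hs hΘ hg =>
    T.distLE_of_genBy ?_ (s.height + 1) s Θ (Nat.lt_succ_self _) hs hΘ hg) hP hQ h
  intro s X Θ hs hΘ hX hsX _ _ hw
  obtain ⟨R, hR, rfl⟩ := exists_den_eq hΘ
  refine T.distLE_iff (P := .state s).2 (T.trans hsX (mayDerivable_extList_le hR fun x hx => ?_))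
  -- The continuation of the prefix is below `Θ'`, hence below `Θ₂`, which `Q` denotes. The prefix
  -- with continuation `Q` is below `Θ₁`, and `Θ₁` is below `Θ`.
  obtain ⟨Θ', ⟨Θ₁, Θ₂, h₁, h₂, h₃⟩, hle⟩ := hw x hx
  have hΘ₁ := h₁.parFreeDist hΘ
  have hΘ₂ := h₂.parFreeDist (fun _ _ h => h.parFreeDist) hΘ₁
  obtain ⟨Q, rfl, hQ⟩ := distLE_may_of_lift_step h₂ hΘ₁
  have hxQ : MayDerivable x.2 Q :=
    T.distLE_iff.1 (T.distLE_trans hle (T.distLE_of_weakTau h₃ hΘ₂))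
  exact T.trans (T.pre x.1 hxQ)
    (T.distLE_iff.1 (T.distLE_trans hQ (T.distLE_of_weakTau h₁ hΘ)))

/-! ### The must theory -/

/-- This produces one inner sum of the left side of Must2. Every state of positive weight can
perform `a` and hence contains a prefix for it. Indices of weight zero are removed because the axiom
requires positive probabilities. -/
theorem exists_bigProb_of_lift_step {r : PCSP Act → PCSP Act → Prop} (T : ChoiceTheory r) {a : Act}
    {Δ Θ : FDist (SCSP Act)} (h : Lift (fun s => Step s (some a)) Δ Θ) (hΔ : ParFreeDist Δ) :
    ∃ (m : ℕ) (p : Fin (m + 1) → ℝ) (hp : ∀ j, 0 < p j) (Q P : Fin (m + 1) → PCSP Act),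
      ∑ j, p j = 1 ∧ (PCSP.bigProb m p hp Q).den = Θ ∧
      DistLE r (PCSP.bigProb m p hp fun j => (PCSP.pre a (Q j)).ext (P j)).den Δ := by
  obtain ⟨n, p, s, Φ, rfl, hstep, rfl⟩ := h
  obtain ⟨k, q, e, rfl, he, hq⟩ := exists_map_fin p
  obtain ⟨m, rfl⟩ : ∃ m, k = m + 1 :=
    Nat.exists_eq_succ_of_ne_zero fun hk => by subst hk; exact q.nonempty.elim Fin.elim0
  rw [iConvexComb_single_comp, StdSimplex.map_map] at *
  have hs (j) : (s (e j)).ParFree :=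
    hΔ _ (weights_map_ne_zero q (fun j => s (e j)) (hq j).ne')
  choose Q P hQ hP hQd hle using fun j => T.exists_ext_pre (hstep (e j)) (hs j) rfl
  refine ⟨m, q.weights, hq, Q, P, ?_, ?_, ?_⟩
  · rw [← q.total, Finsupp.sum_fintype _ _ fun _ => rfl]
  · rw [PCSP.den_bigProb, iConvexComb_map]
    simp only [hQd]
  · have : q.map (fun j => s (e j)) =
        (PCSP.bigProb m q.weights hq fun j => .state (s (e j))).den := by
      rw [PCSP.den_bigProb, ← iConvexComb_single_comp]
      rfl
    rw [this]
    exact bigProb_biConvex T.distLE_biConvex _ _ _ _ _ fun j => ⟨_, _, hle j, rfl, rfl⟩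

theorem mustDerivable_of_genLE {P Q : PCSP Act} (hP : P.ParFree) (hQ : Q.ParFree)
    (h : GenLE True P.den Q.den) : MustDerivable Q P := by
  have T := choiceTheory_must (Act := Act)
  refine T.of_genLE (fun s Θ hs hΘ hg =>
    T.distLE_of_genBy ?_ (s.height + 1) s Θ (Nat.lt_succ_self _) hs hΘ hg) hP hQ h
  intro s X Θ hs hΘ hX hsX hsr hΘr hw
  -- The refusal set is the largest one available: all actions that head no prefix in `X`. The
  -- derivative refusing it plays the role of `R` in Must2.
  obtain ⟨Θr, hwr, hr⟩ := hΘr trivial _ (hsr trivial)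
  obtain ⟨R, hR, hRΘ⟩ := exists_den_eq (hwr.parFreeDist hΘ)
  obtain ⟨U, hU, rfl⟩ := exists_den_eq hΘ
  have hfam (i : Fin X.length) : ∃ (m : ℕ) (p : Fin (m + 1) → ℝ) (hp : ∀ j, 0 < p j)
      (Q P : Fin (m + 1) → PCSP Act), ∑ j, p j = 1 ∧
      MustDerivable (PCSP.bigProb m p hp Q) (X.get i).2 ∧
      MustDerivable U (PCSP.bigProb m p hp fun j => (PCSP.pre (X.get i).1 (Q j)).ext (P j)) := by
    obtain ⟨Θ', ⟨Θ₁, Θ₂, h₁, h₂, h₃⟩, hle⟩ := hw _ (X.get_mem i)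
    have hΘ₁ := h₁.parFreeDist hΘ
    have hΘ₂ := h₂.parFreeDist (fun _ _ h => h.parFreeDist) hΘ₁
    obtain ⟨m, p, hp, Q, P, hsum, rfl, hQP⟩ := exists_bigProb_of_lift_step T h₂ hΘ₁
    exact ⟨m, p, hp, Q, P, hsum,
      T.distLE_iff.1 (T.distLE_trans hle (T.distLE_of_weakTau h₃ hΘ₂)),
      T.distLE_iff.1 (T.distLE_trans hQP (T.distLE_of_weakTau h₁ hΘ))⟩
  choose m p hp Q P hsum hQX hUP using hfam
  -- An initial τ of `R`, or an initial action heading no prefix, would be a transition that some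
  -- state of `Θr` refuses.
  have hinits : R.inits ⊆ Set.range fun i => (some (X.get i).1 : Label Act) := by
    intro α hα
    obtain ⟨t, ht, hα⟩ := PCSP.exists_of_mem_inits hα
    obtain ⟨Δ, hstep⟩ := SCSP.exists_step_of_mem_inits (parFreeDist_den.2 hR t ht) hα
    rw [hRΘ] at ht
    by_contra hcon
    refine hr t (Finsupp.mem_support_iff.2 ht) α ?_ ⟨Δ, hstep⟩
    cases α with
    | none => exact Set.mem_insert _ _
    | some a =>
      refine Or.inr ⟨a, fun x hx hax => hcon ?_, rfl⟩
      obtain ⟨i, rfl⟩ := List.get_of_mem hx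
      exact ⟨i, by rw [hax]⟩
  have hUR : MustDerivable U R := by
    refine T.distLE_iff.1 ?_
    rw [hRΘ]
    exact T.distLE_of_weakTau hwr hΘ
  have hfamily := T.intFamily_le hUR X.length _ hUP
  have hext := T.bigExt_mono X.length _ _ fun i => T.pre (X.get i).1 (hQX i)
  -- Read in the must order: `U` is below the left side of Must2, whose right side has continuations
  -- below those in `X`, and so lies below the normal form of `s`.
  refine T.distLE_iff (P := .state s).2 (T.trans hsX (T.trans (T.extList_le_bigExt X hX)
    (T.trans hext (T.trans ?_ hfamily))))
  exact .ax (T.left_mem hfamily) (T.right_mem hext)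
    (.must2 R X.length (fun i => (X.get i).1) m p hp hsum Q P hinits)

end Completeness

theorem mainTheorem3 {Act : Type*} [Finite Act] (P Q : PCSP Act)
    (hP : P ∈ nCSP Act) (hQ : Q ∈ nCSP Act) :
    (SimLE P Q ↔ MayDerivable P Q) ∧ (FailSimLE P Q ↔ MustDerivable P Q) := by
  refine ⟨⟨fun h => mayDerivable_of_genLE hP hQ ?_, simLE_of_mayDerivable⟩,
    ⟨fun h => mustDerivable_of_genLE hQ hP ?_, failSimLE_of_mustDerivable⟩⟩
  · rwa [GenLE, genBy_false]
  · rwa [GenLE, genBy_true]
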